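/- Let $Q$ be a smooth $n$-dimensional manifold with coordinates $(q^i)$, let $k\ge 0$, let $\mathcal{W}=\oplus^k\mathrm{T}Q\times_Q\oplus^k\mathrm{T}^*Q\times\mathbb{R}^k$ be the extended Pontryagin bundle, with natural coordinates $(q^i,v^i_\alpha,p_i^\alpha,s^\alpha)$ and projections $\rho_1\colon\mathcal{W}\to\oplus^k\mathrm{T}Q\times\mathbb{R}^k$ and $\rho_2\colon\mathcal{W}\to\oplus^k\mathrm{T}^*Q\times\mathbb{R}^k$, and let $\tau_0\colon\oplus^k\mathrm{T}Q\times\mathbb{R}^k\to Q\times\mathbb{R}^k$ be the projection. Let $\eta^\alpha=\mathrm{d}s^\alpha-\rho_2^*\theta^\alpha$ be the contact forms of $\mathcal{W}$, where $\theta^\alpha=p_i^\alpha\,\mathrm{d}q^i$ is the canonical 1-form of the $\alpha$-th copy of $\mathrm{T}^*Q$, and let $(\mathcal{R}_\alpha)$ be a family of Reeb vector fields on $\mathcal{W}$, i.e. $i(\mathcal{R}_\alpha)\mathrm{d}\eta^\beta=0$ and $i(\mathcal{R}_\alpha)\eta^\beta=\delta_\alpha^\beta$. Repeated indices are summed. Let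 $L\in\mathscr{C}^\infty(\oplus^k\mathrm{T}Q\times\mathbb{R}^k)$ be a Lagrangian, regular or singular, with Legendre map (fibre derivative) $\mathcal{F}L\colon\oplus^k\mathrm{T}Q\times\mathbb{R}^k\to\oplus^k\mathrm{T}^*Q\times\mathbb{R}^k$, let $\mathcal{H}=p_i^\alpha v^i_\alpha-L\circ\rho_1$ on $\mathcal{W}$, and let $\mathcal{W}_1=\{w\in\mathcal{W}\mid\rho_2(w)=\mathcal{F}L(\rho_1(w))\}$ be the first constraint submanifold. Let $\mathbf{Z}=(Z_1,\dots,Z_k)$ be a $k$-vector field on $\mathcal{W}$ and let $S\subseteq\mathcal{W}_1$ be a subset (for instance $\mathcal{W}_1$ itself or a final constraint submanifold) such that at every point of $S$ $$ i(Z_\alpha)\mathrm{d}\eta^\alpha=\mathrm{d}\mathcal{H}-(\mathscr{L}_{\mathcal{R}_\alpha}\mathcal{H})\,\eta^\alpha,\qquad i(Z_\alpha)\eta^\alpha=-\mathcal{H}, $$ and $\mathbf{Z}$ is integrable along $S$: every point of $S$ is in the image of an integral section of $\mathbf{Z}$ with values in $S$. Let $\psi\colon U\to S\subseteq\mathcal{W}_1$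 be a smooth integral section of $\mathbf{Z}$ defined on an open set $U\subseteq\mathbb{R}^k$ (for instance $U=\mathbb{R}^k$), so that $\psi=(\psi_L,\mathcal{F}L\circ\psi_L)$ with $\psi_L=\rho_1\circ\psi$, and let $\phi=\tau_0\circ\rho_1\circ\psi\colon U\to Q\times\mathbb{R}^k$. Then $\psi_L$ is the first prolongation of $\phi$: if $\phi=(\phi_Q,s)$, then $\psi_L(t)=\big(\phi_Q(t);\mathrm{T}\phi_Q(\partial/\partial t^1|_t),\dots,\mathrm{T}\phi_Q(\partial/\partial t^k|_t);s(t)\big)$ for all $t\in U$. Moreover $\phi$ solves the $k$-contact Euler–Lagrange equations, in both of the following forms. (a) In the natural coordinates $(q^i,v^i_\alpha,s^\alpha)$ induced by any chart of $Q$, $$ \frac{\partial}{\partial t^\alpha}\Big(\frac{\partial L}{\partial v^i_\alpha}\circ\psi_L\Big)=\Big(\frac{\partial L}{\partial q^i}+\frac{\partial L}{\partial s^\alpha}\frac{\partial L}{\partial v^i_\alpha}\Big)\circ\psi_L,\qquad \frac{\partial (s^\alpha\circ\psi_L)}{\partial t^\alpha}=L\circ\psi_L . $$ (b) Let $E_L=\Delta(L)-L$,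 with $\Delta=v^i_\alpha\,\partial/\partial v^i_\alpha$ the Liouville vector field, let $\eta^\alpha_L=\mathrm{d}s^\alpha-\mathrm{d}L\circ J^\alpha$, with $J^\alpha=\partial/\partial v^i_\alpha\otimes\mathrm{d}q^i$ the canonical $k$-tangent structure, and let $(\psi_L)'_\alpha=\mathrm{T}\psi_L(\partial/\partial t^\alpha)$. For every $t\in U$ and all tangent vectors $(\mathcal{R}_L)_1,\dots,(\mathcal{R}_L)_k$ at $\psi_L(t)$ satisfying the Reeb conditions $i((\mathcal{R}_L)_\alpha)\mathrm{d}\eta_L^\beta=0$, $i((\mathcal{R}_L)_\alpha)\eta_L^\beta=\delta^\beta_\alpha$ at that point (in particular for the values of any local or global Reeb vector fields), one has at $\psi_L(t)$ $$ i((\psi_L)'_\alpha)\mathrm{d}\eta^\alpha_L=\mathrm{d}E_L-\big((\mathcal{R}_L)_\alpha E_L\big)\eta^\alpha_L,\qquad i((\psi_L)'_\alpha)\eta^\alpha_L=-E_L . $$ -/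

import Mathlib

open scoped Manifold ContDiff Bundle

noncomputable section

namespace KContact

/-! ### Forms on manifolds and `k`-vector fields -/

section General

variable {E : Type*} [NormedAddCommGroup E] [NormedSpace ℝ E] {H : Type*} [TopologicalSpace H]
  (I : ModelWithCorners ℝ E H) {M : Type*} [TopologicalSpace M] [ChartedSpace H M]

/-- The differential of a real function, as a 1-form. -/
def differential (f : M → ℝ) (x : M) : TangentSpace I x →L[ℝ] ℝ :=
  (NormedSpace.fromTangentSpace (𝕜 := ℝ) (f x) : TangentSpace 𝓘(ℝ, ℝ) (f x) →L[ℝ] ℝ) ∘L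
    mfderiv I 𝓘(ℝ, ℝ) f x

/-- A 1-form `η` read in the preferred chart at `x`: the pull-back of `η` by the inverse chart. -/
def formInChart (η : ∀ x : M, TangentSpace I x →L[ℝ] ℝ) (x : M) (y : E) : E →L[ℝ] ℝ :=
  η ((extChartAt I x).symm y) ∘L mfderiv 𝓘(ℝ, E) I (extChartAt I x).symm y

/-- The exterior derivative of a 1-form on a manifold without boundary, computed at each point in
the preferred chart at that point. -/
def extDerivForm [I.Boundaryless] (η : ∀ x : M, TangentSpace I x →L[ℝ] ℝ) (x : M)
    (u w : TangentSpace I x) : ℝ :=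
  extDeriv (fun y : E => ContinuousAlternatingMap.ofSubsingleton ℝ E ℝ (0 : Fin 1)
      (formInChart I η x y)) (extChartAt I x x)
    ![mfderiv I 𝓘(ℝ, E) (extChartAt I x) x u, mfderiv I 𝓘(ℝ, E) (extChartAt I x) x w]

/-- A (smooth) vector field. -/
def IsSmoothField [IsManifold I ∞ M] (X : ∀ x : M, TangentSpace I x) : Prop :=
  ContMDiff I I.tangent ∞ (fun x => (⟨x, X x⟩ : TangentBundle I M))

variable {k : ℕ}

/-- The partial velocity `ψ'_α (t) = Tψ (∂/∂t^α)`. -/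
def velocity (ψ : (Fin k → ℝ) → M) (α : Fin k) (t : Fin k → ℝ) : TangentSpace I (ψ t) :=
  mfderiv 𝓘(ℝ, Fin k → ℝ) I ψ t (Pi.single α (1 : ℝ) : Fin k → ℝ)

/-- `ψ : U ⊆ ℝ^k → M` is an integral section of the `k`-vector field `Z = (Z_1, …, Z_k)`. -/
def IsIntegralSection (Z : Fin k → ∀ x : M, TangentSpace I x) (U : Set (Fin k → ℝ))
    (ψ : (Fin k → ℝ) → M) : Prop :=
  IsOpen U ∧ ContMDiffOn 𝓘(ℝ, Fin k → ℝ) I ∞ ψ U ∧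
    ∀ t ∈ U, ∀ α, velocity I ψ α t = Z α (ψ t)

/-- Integrability along a subset `S`: every point of `S` lies in the image of an integral section
with values in `S`. For `S = univ` this is integrability of `Z`. -/
def IsIntegrableOn (Z : Fin k → ∀ x : M, TangentSpace I x) (S : Set M) : Prop :=
  ∀ x ∈ S, ∃ (U : Set (Fin k → ℝ)) (ψ : (Fin k → ℝ) → M),
    IsIntegralSection I Z U ψ ∧ Set.MapsTo ψ U S ∧ x ∈ ψ '' U

/-- `R_1, …, R_k ∈ T_x M` satisfy the Reeb conditions `i(R_α) dη^β = 0`, `i(R_α) η^β = δ_α^β`. -/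
def IsReebAt [I.Boundaryless] (η : Fin k → ∀ x : M, TangentSpace I x →L[ℝ] ℝ) (x : M)
    (R : Fin k → TangentSpace I x) : Prop :=
  ∀ α β, (∀ u, extDerivForm I (η β) x (R α) u = 0) ∧ η β x (R α) = if α = β then 1 else 0

/-- A family of Reeb vector fields on `M`. -/
def IsReebFamily [I.Boundaryless] [IsManifold I ∞ M]
    (η : Fin k → ∀ x : M, TangentSpace I x →L[ℝ] ℝ)
    (R : Fin k → ∀ x : M, TangentSpace I x) : Prop :=
  (∀ α, IsSmoothField I (R α)) ∧ ∀ x, IsReebAt I η x (fun α => R α x)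

/-- The field equations at a point `x`, for tangent vectors `Z_1, …, Z_k` and Reeb vectors
`R_1, …, R_k` at `x`:
`i(Z_α) dη^α = dh - (L_{R_α} h) η^α`, `i(Z_α) η^α = -h` (sums over `α`). -/
def FieldEquationsAt [I.Boundaryless] (η : Fin k → ∀ x : M, TangentSpace I x →L[ℝ] ℝ)
    (h : M → ℝ) (x : M) (R Z : Fin k → TangentSpace I x) : Prop :=
  (∀ u : TangentSpace I x, ∑ α, extDerivForm I (η α) x (Z α) u =
      differential I h x u - ∑ α, differential I h x (R α) * η α x u) ∧
    ∑ α, η α x (Z α) = - h x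

end General

/-! ### The bundles

The direct sum `⊕^k TQ` is realised as the bundle with fibre `Hom(ℝ^k, T_q Q)` (with
`v_α = v(e_α)`), and `⊕^k T*Q` as the bundle with fibre `Hom(T_q Q, ℝ^k)` (with `p^α` the
`α`-th component). -/

section Bundles

variable (n k : ℕ) (Q : Type*) [TopologicalSpace Q] [ChartedSpace (EuclideanSpace ℝ (Fin n)) Q]
  [IsManifold (𝓡 n) ∞ Q]

/-- Model fibre of `⊕^k TQ`. -/
abbrev VelModel := (Fin k → ℝ) →L[ℝ] EuclideanSpace ℝ (Fin n)

/-- Model fibre of `⊕^k T*Q`. -/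
abbrev MomModel := EuclideanSpace ℝ (Fin n) →L[ℝ] (Fin k → ℝ)

/-- Fibre of `⊕^k TQ` at `q`. -/
abbrev VelFibre (q : Q) := Bundle.Trivial Q (Fin k → ℝ) q →L[ℝ] TangentSpace (𝓡 n) q

/-- Fibre of `⊕^k T*Q` at `q`. -/
abbrev MomFibre (q : Q) := TangentSpace (𝓡 n) q →L[ℝ] Bundle.Trivial Q (Fin k → ℝ) q

/-- `⊕^k TQ × ℝ^k`. -/
abbrev LagSpace := Bundle.TotalSpace (VelModel n k) (VelFibre n k Q) × (Fin k → ℝ)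

/-- `⊕^k T*Q × ℝ^k`. -/
abbrev HamSpace := Bundle.TotalSpace (MomModel n k) (MomFibre n k Q) × (Fin k → ℝ)

/-- The extended Pontryagin bundle `W = ⊕^k TQ ×_Q ⊕^k T*Q × ℝ^k`. -/
abbrev Pontryagin :=
  Bundle.TotalSpace (VelModel n k × MomModel n k) (VelFibre n k Q ×ᵇ MomFibre n k Q) ×
    (Fin k → ℝ)

/-- Model with corners (without boundary) of `⊕^k TQ × ℝ^k`. -/
abbrev lagI := ((𝓡 n).prod 𝓘(ℝ, VelModel n k)).prod 𝓘(ℝ, Fin k → ℝ)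

/-- Model with corners (without boundary) of `⊕^k T*Q × ℝ^k`. -/
abbrev hamI := ((𝓡 n).prod 𝓘(ℝ, MomModel n k)).prod 𝓘(ℝ, Fin k → ℝ)

/-- Model with corners (without boundary) of the extended Pontryagin bundle. -/
abbrev pontI := ((𝓡 n).prod 𝓘(ℝ, VelModel n k × MomModel n k)).prod 𝓘(ℝ, Fin k → ℝ)

end Bundles

section Objects

variable {n k : ℕ} {Q : Type*} [TopologicalSpace Q] [ChartedSpace (EuclideanSpace ℝ (Fin n)) Q]
  [IsManifold (𝓡 n) ∞ Q]

/-- `τ_0 : ⊕^k TQ × ℝ^k → Q × ℝ^k`. -/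
def tau0 (x : LagSpace n k Q) : Q × (Fin k → ℝ) := (x.1.proj, x.2)

/-- The projection `⊕^k TQ × ℝ^k → Q`. -/
def tauQ (x : LagSpace n k Q) : Q := x.1.proj

/-- The projection `⊕^k T*Q × ℝ^k → Q`. -/
def piQ (x : HamSpace n k Q) : Q := x.1.proj

/-- `ρ_1 : W → ⊕^k TQ × ℝ^k`. -/
def rho1 (w : Pontryagin n k Q) : LagSpace n k Q := (⟨w.1.proj, w.1.snd.1⟩, w.2)

/-- `ρ_2 : W → ⊕^k T*Q × ℝ^k`. -/
def rho2 (w : Pontryagin n k Q) : HamSpace n k Q := (⟨w.1.proj, w.1.snd.2⟩, w.2)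

/-- The velocities `v = (v_1, …, v_k)` of a point of `⊕^k TQ × ℝ^k`. -/
def velocities (x : LagSpace n k Q) : VelModel n k := x.1.snd

/-- The component `v_α ∈ T_q Q` of a point of `⊕^k TQ × ℝ^k`. -/
def velComp (x : LagSpace n k Q) (α : Fin k) : TangentSpace (𝓡 n) (tauQ x) :=
  velocities x (Pi.single α 1)

/-- The covector `p^α ∈ T_q^* Q` of a point of `⊕^k T*Q × ℝ^k`. -/
def momComp (x : HamSpace n k Q) (α : Fin k) : TangentSpace (𝓡 n) (piQ x) →L[ℝ] ℝ :=
  (ContinuousLinearMap.proj (R := ℝ) (φ := fun _ : Fin k => ℝ) α) ∘L x.1.snd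

/-- Inclusion of the fibre of `⊕^k TQ × ℝ^k → Q × ℝ^k` over `(q, s)`. -/
def fibreIncl (q : Q) (s : Fin k → ℝ) (v : VelModel n k) : LagSpace n k Q := (⟨q, v⟩, s)

/-- The element `(0, …, u, …, 0)` of `⊕^k T_q Q`, with `u` in the `α`-th place. -/
def inSlot {q : Q} (α : Fin k) : TangentSpace (𝓡 n) q →L[ℝ] VelModel n k :=
  ContinuousLinearMap.smulRightL ℝ (Fin k → ℝ) (EuclideanSpace ℝ (Fin n))
    (ContinuousLinearMap.proj (R := ℝ) (φ := fun _ : Fin k => ℝ) α)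

/-! ### Lagrangian objects on `⊕^k TQ × ℝ^k` -/

/-- The vertical `α`-th lift of `u ∈ T_q Q` at `x`: the derivative at `0` of the curve
`a ↦ (v_1, …, v_α + a u, …, v_k)`. -/
def verticalLift (x : LagSpace n k Q) (α : Fin k) :
    TangentSpace (𝓡 n) (tauQ x) →L[ℝ] TangentSpace (lagI n k) x :=
  mfderiv 𝓘(ℝ, VelModel n k) (lagI n k) (fibreIncl (tauQ x) x.2) (velocities x) ∘L
    inSlot α

/-- The canonical `k`-tangent structure, `J^α (Z) = (Tτ Z)^α`. -/
def tangentStructure (α : Fin k) (x : LagSpace n k Q) :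
    TangentSpace (lagI n k) x →L[ℝ] TangentSpace (lagI n k) x :=
  verticalLift x α ∘L mfderiv (lagI n k) (𝓡 n) tauQ x

/-- The Liouville vector field `Δ = ∑ Δ_α = v^i_α ∂/∂v^i_α`. -/
def liouville (x : LagSpace n k Q) : TangentSpace (lagI n k) x :=
  ∑ α, verticalLift x α (velComp x α)

/-- The Lagrangian energy `E_L = Δ(L) - L`. -/
def energy (L : LagSpace n k Q → ℝ) (x : LagSpace n k Q) : ℝ :=
  differential (lagI n k) L x (liouville x) - L x

/-- The Cartan 1-forms `θ_L^α = dL ∘ J^α`. -/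
def cartanForm (L : LagSpace n k Q → ℝ) (α : Fin k) (x : LagSpace n k Q) :
    TangentSpace (lagI n k) x →L[ℝ] ℝ :=
  differential (lagI n k) L x ∘L tangentStructure α x

/-- The contact 1-forms `η_L^α = ds^α - θ_L^α`. -/
def lagContactForm (L : LagSpace n k Q → ℝ) (α : Fin k) (x : LagSpace n k Q) :
    TangentSpace (lagI n k) x →L[ℝ] ℝ :=
  differential (lagI n k) (fun y : LagSpace n k Q => y.2 α) x - cartanForm L α x

/-- The Legendre map: the fibre derivative of `L` on `⊕^k TQ × ℝ^k → Q × ℝ^k`. -/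
def legendre (L : LagSpace n k Q → ℝ) (x : LagSpace n k Q) : HamSpace n k Q :=
  (⟨tauQ x, ContinuousLinearMap.pi fun α =>
    fderiv ℝ (fun v : VelModel n k => L (fibreIncl (tauQ x) x.2 v)) (velocities x) ∘L
      inSlot α⟩, x.2)

/-! ### The precontact structure of the extended Pontryagin bundle -/

/-- The canonical 1-form `θ^α` on `⊕^k T*Q × ℝ^k`, `θ^α (Z) = p^α (Tπ Z)`. -/
def canonicalForm (α : Fin k) (x : HamSpace n k Q) : TangentSpace (hamI n k) x →L[ℝ] ℝ :=
  momComp x α ∘L mfderiv (hamI n k) (𝓡 n) piQ x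

/-- The contact 1-forms `η^α = ds^α - ρ_2^* θ^α` on `W`. -/
def contactForm (α : Fin k) (w : Pontryagin n k Q) : TangentSpace (pontI n k) w →L[ℝ] ℝ :=
  differential (pontI n k) (fun y : Pontryagin n k Q => y.2 α) w -
    canonicalForm α (rho2 w) ∘L mfderiv (pontI n k) (hamI n k) rho2 w

/-- The coupling function `C = ∑ p^α (v_α)`. -/
def coupling (w : Pontryagin n k Q) : ℝ :=
  ∑ α, momComp (rho2 w) α (velComp (rho1 w) α)

/-- The Hamiltonian function `H = C - L ∘ ρ_1`. -/
def hamiltonian (L : LagSpace n k Q → ℝ) (w : Pontryagin n k Q) : ℝ :=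
  coupling w - L (rho1 w)

/-- The first constraint submanifold `W_1`: the graph of the Legendre map. -/
def firstConstraint (L : LagSpace n k Q → ℝ) : Set (Pontryagin n k Q) :=
  {w | rho2 w = legendre L (rho1 w)}

/-- `Z` solves the Skinner–Rusk `k`-contact equations at all points of `S`, with respect to the
family `R` of Reeb vector fields of `W`. -/
def SolvesSkinnerRuskOn (L : LagSpace n k Q → ℝ)
    (R Z : Fin k → ∀ w : Pontryagin n k Q, TangentSpace (pontI n k) w)
    (S : Set (Pontryagin n k Q)) : Prop :=
  ∀ w ∈ S, FieldEquationsAt (pontI n k) contactForm (hamiltonian L) w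
    (fun α => R α w) (fun α => Z α w)

/-! ### Euler–Lagrange equations -/

/-- First prolongation of `φ = (φ_Q, s) : ℝ^k → Q × ℝ^k`: the map
`t ↦ (φ_Q(t); Tφ_Q(∂/∂t^1), …, Tφ_Q(∂/∂t^k); s(t))`. -/
def prolongation (φ : (Fin k → ℝ) → Q × (Fin k → ℝ)) (t : Fin k → ℝ) : LagSpace n k Q :=
  (⟨(φ t).1, (mfderiv 𝓘(ℝ, Fin k → ℝ) (𝓡 n) (fun τ => (φ τ).1) t :)⟩, (φ t).2)

/-- Inverse of the natural coordinates `(q^i, v^i_α, s^α)` of `⊕^k TQ × ℝ^k` induced by a chart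
`c` of `Q`. -/
def fromCoords (c : OpenPartialHomeomorph Q (EuclideanSpace ℝ (Fin n)))
    (y : EuclideanSpace ℝ (Fin n) × VelModel n k × (Fin k → ℝ)) : LagSpace n k Q :=
  fibreIncl (c.symm y.1) y.2.2 (mfderiv (𝓡 n) (𝓡 n) c.symm y.1 ∘L y.2.1)

/-- The natural coordinates `(q^i, v^i_α, s^α)` of `⊕^k TQ × ℝ^k` induced by a chart `c`. -/
def toCoords (c : OpenPartialHomeomorph Q (EuclideanSpace ℝ (Fin n))) (x : LagSpace n k Q) :
    EuclideanSpace ℝ (Fin n) × VelModel n k × (Fin k → ℝ) :=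
  (c (tauQ x), mfderiv (𝓡 n) (𝓡 n) c (tauQ x) ∘L velocities x, x.2)

/-- `∂L/∂q^i` in the coordinates induced by `c`. -/
def dLdq (c : OpenPartialHomeomorph Q (EuclideanSpace ℝ (Fin n))) (L : LagSpace n k Q → ℝ)
    (i : Fin n) (x : LagSpace n k Q) : ℝ :=
  fderiv ℝ (fun y => L (fromCoords c y)) (toCoords c x) (EuclideanSpace.single i 1, 0, 0)

/-- `∂L/∂v^i_α` in the coordinates induced by `c`. -/
def dLdv (c : OpenPartialHomeomorph Q (EuclideanSpace ℝ (Fin n))) (L : LagSpace n k Q → ℝ)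
    (i : Fin n) (α : Fin k) (x : LagSpace n k Q) : ℝ :=
  fderiv ℝ (fun y => L (fromCoords c y)) (toCoords c x)
    (0, ContinuousLinearMap.smulRight
      (ContinuousLinearMap.proj (R := ℝ) (φ := fun _ : Fin k => ℝ) α)
      (EuclideanSpace.single i (1 : ℝ)), 0)

/-- `∂L/∂s^α` in the coordinates induced by `c`. -/
def dLds (c : OpenPartialHomeomorph Q (EuclideanSpace ℝ (Fin n))) (L : LagSpace n k Q → ℝ)
    (α : Fin k) (x : LagSpace n k Q) : ℝ :=
  fderiv ℝ (fun y => L (fromCoords c y)) (toCoords c x) (0, 0, Pi.single α 1)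

/-- `∂f/∂t^α` for a function `f` on `ℝ^k`. -/
def partialDeriv (f : (Fin k → ℝ) → ℝ) (α : Fin k) (t : Fin k → ℝ) : ℝ :=
  fderiv ℝ f t (Pi.single α 1)

/-- The `k`-contact Euler–Lagrange equations on `U` for a map `ψ` into `⊕^k TQ × ℝ^k`, in the
natural coordinates of every chart of `Q`. -/
def EulerLagrangeCoords (L : LagSpace n k Q → ℝ) (U : Set (Fin k → ℝ))
    (ψ : (Fin k → ℝ) → LagSpace n k Q) : Prop :=
  (∀ c ∈ IsManifold.maximalAtlas (𝓡 n) ∞ Q, ∀ t ∈ U, tauQ (ψ t) ∈ c.source → ∀ i : Fin n,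
    ∑ α, partialDeriv (fun τ => dLdv c L i α (ψ τ)) α t =
      dLdq c L i (ψ t) + ∑ α, dLds c L α (ψ t) * dLdv c L i α (ψ t)) ∧
  ∀ t ∈ U, ∑ α, partialDeriv (fun τ => (ψ τ).2 α) α t = L (ψ t)

/-- The `k`-contact Euler–Lagrange equations on `U` in geometric form,
`i(ψ'_α) dη_L^α = (dE_L - (L_{R_α} E_L) η_L^α) ∘ ψ`, `i(ψ'_α) η_L^α = - E_L ∘ ψ`,
for every choice of Reeb vectors of the forms `η_L^α` at the points `ψ(t)`; in particular for every
(local or global) family of Reeb vector fields. -/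
def EulerLagrangeGeometric (L : LagSpace n k Q → ℝ) (U : Set (Fin k → ℝ))
    (ψ : (Fin k → ℝ) → LagSpace n k Q) : Prop :=
  ∀ t ∈ U, ∀ R : Fin k → TangentSpace (lagI n k) (ψ t),
    IsReebAt (lagI n k) (lagContactForm L) (ψ t) R →
    FieldEquationsAt (lagI n k) (lagContactForm L) (energy L) (ψ t) R
      (fun α => velocity (lagI n k) ψ α t)

/-- `φ : U → Q × ℝ^k` is a solution of the `k`-contact Euler–Lagrange equations: its first
prolongation satisfies them. The coordinate form also makes sense for singular Lagrangians whose
forms `η_L^α` admit no Reeb vectors. -/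
def IsEulerLagrangeSolution (L : LagSpace n k Q → ℝ) (U : Set (Fin k → ℝ))
    (φ : (Fin k → ℝ) → Q × (Fin k → ℝ)) : Prop :=
  ContMDiffOn 𝓘(ℝ, Fin k → ℝ) ((𝓡 n).prod 𝓘(ℝ, Fin k → ℝ)) ∞ φ U ∧
    EulerLagrangeGeometric L U (prolongation (n := n) φ) ∧
    EulerLagrangeCoords L U (prolongation (n := n) φ)

end Objects

end KContact

end

/-! In natural coordinates `η^α = ds^α - p_i^α dq^i`, so `dη^α = dq^i ∧ dp_i^α`, and the
Skinner–Rusk equations at a point split when tested on coordinate directions. The `dp`-part says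
that the `q`-component of `Z_α` is `v_α`. No regularity of `L` is needed for this, because the
momenta are independent coordinates on `W`; this is the source of the first prolongation. A Reeb
vector `R_α` has zero `q`- and `p`-components and `s`-components `δ_α^β`. Its `v`-component is
arbitrary, but `∂H/∂v = p - ∂L/∂v` vanishes on `W_1`, so `R_α H = -∂L/∂s^α` for every choice. With
this value the `dq`-part becomes `∑ (Z_α)_{p_i^α} = ∂L/∂q^i + (∂L/∂s^α) p_i^α`, and the scalar
equation becomes `∑ (Z_α)_{s^α} = L`. This is `skinnerRusk_coords`.

Along `ψ` the identity `p = ∂L/∂v` holds on an open set, so it may be differentiated: the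
`p`-velocity of `ψ` is the derivative of `∂L/∂v` along `ψ_L` (`coords_rho1_comp`). This turns the
above into the coordinate Euler–Lagrange equations.

For the geometric form, `dη_L^α` may be degenerate and the Reeb conditions need not determine `R_α`.
Still, testing them on the velocities of `ψ_L` and using the coordinate equations gives `R_α E_L =
-∂L/∂s^α` at the point; the rest is substitution (`eulerLagrange_coords`).

The remaining work is to justify the coordinate expressions. Exterior derivatives are defined in the
preferred chart at each point; `IsLocalCoords.extDerivForm_eq` moves them to any coordinate system,
and `isLocalCoords_lag` and `isLocalCoords_pont` supply those induced by an arbitrary chart of `Q`.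
-/

noncomputable section

namespace KContact

open Filter Topology

/-! ### Local coordinates on a manifold -/

section LocalCoordinates

variable {E : Type*} [NormedAddCommGroup E] [NormedSpace ℝ E] {H : Type*} [TopologicalSpace H]
  (I : ModelWithCorners ℝ E H) {M : Type*} [TopologicalSpace M] [ChartedSpace H M]
  {F : Type*} [NormedAddCommGroup F] [NormedSpace ℝ F]

/-- `Ψ : M → F` is a smooth system of coordinates near `x`, with inverse `Φ`. -/
structure IsLocalCoords (Φ : F → M) (Ψ : M → F) (x : M) : Prop where
  contMDiffAt_symm : ContMDiffAt 𝓘(ℝ, F) I ∞ Φ (Ψ x)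
  contMDiffAt : ContMDiffAt I 𝓘(ℝ, F) ∞ Ψ x
  left_inv : ∀ᶠ y in 𝓝 (Ψ x), Ψ (Φ y) = y
  right_inv : ∀ᶠ z in 𝓝 x, Φ (Ψ z) = z

/-- The derivative of a vector-valued map on a manifold, with the tangent spaces unfolded. -/
def coordDeriv (Ψ : M → F) (x : M) : E →L[ℝ] F := mfderiv I 𝓘(ℝ, F) Ψ x

/-- The derivative of a parametrization, with the tangent spaces unfolded. -/
def paramDeriv (Φ : F → M) (y : F) : F →L[ℝ] E := mfderiv 𝓘(ℝ, F) I Φ y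

/-- The pull-back of a 1-form under a parametrization. -/
def pullForm (η : ∀ x : M, TangentSpace I x →L[ℝ] ℝ) (Φ : F → M) (y : F) : F →L[ℝ] ℝ :=
  (η (Φ y) : E →L[ℝ] ℝ) ∘L paramDeriv I Φ y

variable {I} {Φ : F → M} {Ψ : M → F} {x : M}

namespace IsLocalCoords

variable (hc : IsLocalCoords I Φ Ψ x)
include hc

theorem symm_self : Φ (Ψ x) = x := hc.right_inv.self_of_nhds

theorem mdifferentiableAt : MDifferentiableAt I 𝓘(ℝ, F) Ψ x :=
  hc.contMDiffAt.mdifferentiableAt (by simp)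

theorem mdifferentiableAt_symm : MDifferentiableAt 𝓘(ℝ, F) I Φ (Ψ x) :=
  hc.contMDiffAt_symm.mdifferentiableAt (by simp)

theorem coordDeriv_paramDeriv (u : F) : coordDeriv I Ψ x (paramDeriv I Φ (Ψ x) u) = u := by
  have h1 : MDifferentiableAt I 𝓘(ℝ, F) Ψ (Φ (Ψ x)) := by
    rw [hc.symm_self]; exact hc.mdifferentiableAt
  have h2 := mfderiv_comp (Ψ x) h1 hc.mdifferentiableAt_symm
  have h3 : Ψ ∘ Φ =ᶠ[𝓝 (Ψ x)] id := hc.left_inv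
  rw [h3.mfderiv_eq, mfderiv_id] at h2
  have h4 := DFunLike.congr_fun h2 u
  have h5 : coordDeriv I Ψ (Φ (Ψ x)) = coordDeriv I Ψ x := by rw [hc.symm_self]
  rw [← h5]
  exact h4.symm

theorem exists_coordDeriv_eq (w : F) : ∃ u : TangentSpace I x, coordDeriv I Ψ x u = w :=
  ⟨paramDeriv I Φ (Ψ x) w, hc.coordDeriv_paramDeriv w⟩

theorem coordDeriv_velocity {k : ℕ} {ψ : (Fin k → ℝ) → M} {t : Fin k → ℝ} (hx : ψ t = x)
    (hψ : MDifferentiableAt 𝓘(ℝ, Fin k → ℝ) I ψ t) (α : Fin k) :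
    coordDeriv I Ψ x (velocity I ψ α t) = fderiv ℝ (Ψ ∘ ψ) t (Pi.single α 1) := by
  subst hx
  have h2 := mfderiv_comp t hc.mdifferentiableAt hψ
  rw [mfderiv_eq_fderiv] at h2
  exact (DFunLike.congr_fun h2 _).symm

end IsLocalCoords

/-- This fixes the sign and the normalisation, with no factor 1/2, of all later formulas for `dη`.
-/
theorem extDeriv_ofSubsingleton_apply {ζ : F → F →L[ℝ] ℝ} {y : F} (hζ : DifferentiableAt ℝ ζ y)
    (u w : F) :
    extDeriv (fun y => ContinuousAlternatingMap.ofSubsingleton ℝ F ℝ (0 : Fin 1) (ζ y)) y ![u, w] =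
      fderiv ℝ ζ y u w - fderiv ℝ ζ y w u := by
  have h1 : HasFDerivAt
      (fun y => ContinuousAlternatingMap.ofSubsingleton ℝ F ℝ (0 : Fin 1) (ζ y))
      (((ContinuousAlternatingMap.ofSubsingletonLIE (𝕜 := ℝ) (E := F) (F := ℝ) (0 : Fin 1)).toContinuousLinearEquiv :
        (F →L[ℝ] ℝ) →L[ℝ] _) ∘L fderiv ℝ ζ y) y :=
    ((ContinuousAlternatingMap.ofSubsingletonLIE (𝕜 := ℝ) (E := F) (F := ℝ)
      (0 : Fin 1)).toContinuousLinearEquiv.hasFDerivAt).comp y hζ.hasFDerivAt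
  rw [extDeriv, h1.fderiv, ContinuousAlternatingMap.alternatizeUncurryFin_apply]
  simp [Fin.sum_univ_two, Fin.removeNth]
  ring

/-- A 1-form which reads `ζ` in the coordinates `Ψ` at all points near `x` pulls back to `ζ`. -/
theorem pullForm_eventuallyEq {η : ∀ x : M, TangentSpace I x →L[ℝ] ℝ} {ζ : F → F →L[ℝ] ℝ}
    (hx : IsLocalCoords I Φ Ψ x)
    (h : ∀ᶠ z in 𝓝 x, IsLocalCoords I Φ Ψ z ∧
      ∀ u : TangentSpace I z, η z u = ζ (Ψ z) (coordDeriv I Ψ z u)) :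
    pullForm I η Φ =ᶠ[𝓝 (Ψ x)] ζ := by
  have hcont := hx.contMDiffAt_symm.continuousAt
  rw [ContinuousAt, hx.symm_self] at hcont
  filter_upwards [hcont.eventually h, hx.left_inv] with y hy hy'
  ext u
  have h1 := hy.2 (paramDeriv I Φ y u)
  have h2 := hy.1.coordDeriv_paramDeriv u
  rw [hy'] at h1 h2
  exact h1.trans (congrArg (ζ y) h2)

theorem differential_eq_of_eventuallyEq {h : M → ℝ} {g : F → ℝ}
    (hΨ : MDifferentiableAt I 𝓘(ℝ, F) Ψ x) (hg : DifferentiableAt ℝ g (Ψ x))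
    (hgh : h =ᶠ[𝓝 x] g ∘ Ψ) (u : TangentSpace I x) :
    differential I h x u = fderiv ℝ g (Ψ x) (coordDeriv I Ψ x u) := by
  have h2 := mfderiv_comp x hg.mdifferentiableAt hΨ
  rw [← hgh.mfderiv_eq, mfderiv_eq_fderiv] at h2
  exact DFunLike.congr_fun h2 u

variable [IsManifold I ∞ M] [I.Boundaryless]

/-- Near the point the inverse chart `e.symm` equals `Φ ∘ (Ψ ∘ e.symm)`, so pulling `η` back along
it means pulling back along `Φ`, which gives `ζ`, and then along the transition map. -/
theorem IsLocalCoords.formInChart_eventuallyEq (hc : IsLocalCoords I Φ Ψ x)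
    {η : ∀ x : M, TangentSpace I x →L[ℝ] ℝ} {ζ : F → F →L[ℝ] ℝ}
    (hηζ : pullForm I η Φ =ᶠ[𝓝 (Ψ x)] ζ) :
    formInChart I η x =ᶠ[𝓝 (extChartAt I x x)] fun y =>
      ζ ((Ψ ∘ (extChartAt I x).symm) y) ∘L fderiv ℝ (Ψ ∘ (extChartAt I x).symm) y := by
  set e := extChartAt I x
  have hex : e.symm (e x) = x := extChartAt_to_inv x
  have hsymm : ContinuousAt e.symm (e x) := continuousAt_extChartAt_symm x
  rw [ContinuousAt, hex] at hsymm
  have hΨ1 : ContMDiffAt I 𝓘(ℝ, F) 1 Ψ x := hc.contMDiffAt.of_le (by simp)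
  have hΦ1 : ContMDiffAt 𝓘(ℝ, F) I 1 Φ (Ψ x) := hc.contMDiffAt_symm.of_le (by simp)
  have : IsManifold I 1 M := IsManifold.of_le (n := ∞) (by simp)
  have e1 := hsymm.eventually ((contMDiffAt_iff_contMDiffAt_nhds (by simp)).1 hΨ1)
  have e2 := hsymm.eventually (hc.contMDiffAt.continuousAt.eventually ((contMDiffAt_iff_contMDiffAt_nhds (by simp)).1 hΦ1))
  have e3 := hsymm.eventually hc.right_inv.eventually_nhds
  have e4 := hsymm.eventually (hc.contMDiffAt.continuousAt.eventually hηζ)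
  have e5 := extChartAt_target_mem_nhds (I := I) x
  filter_upwards [e1, e2, e3, e4, e5] with y h1 h2 h3 h4 h5
  have hs : MDifferentiableAt 𝓘(ℝ, E) I e.symm y := by
    have := mdifferentiableWithinAt_extChartAt_symm (I := I) h5
    rwa [I.range_eq_univ, mdifferentiableWithinAt_univ] at this
  have h1' : MDifferentiableAt I 𝓘(ℝ, F) Ψ (e.symm y) := h1.mdifferentiableAt (by simp)
  have hg : MDifferentiableAt 𝓘(ℝ, E) 𝓘(ℝ, F) (Ψ ∘ e.symm) y := h1'.comp y hs
  have h2' : MDifferentiableAt 𝓘(ℝ, F) I Φ ((Ψ ∘ e.symm) y) := h2.mdifferentiableAt (by simp)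
  have hcomp := mfderiv_comp y h2' hg
  have heq : Φ ∘ Ψ ∘ e.symm =ᶠ[𝓝 y] e.symm := by
    filter_upwards [hs.continuousAt.eventually h3] with z hz using hz
  rw [heq.mfderiv_eq, mfderiv_eq_fderiv] at hcomp
  ext v
  -- The two base points are only propositionally equal, so the covectors are compared on the model
  -- space `E`.
  have hpt : (η (Φ ((Ψ ∘ e.symm) y)) : E →L[ℝ] ℝ) = η (e.symm y) := by
    rw [show Φ ((Ψ ∘ e.symm) y) = e.symm y from heq.self_of_nhds]
  rw [ContinuousLinearMap.comp_apply]
  erw [← h4]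
  exact (congrArg (η (e.symm y) : E →L[ℝ] ℝ) (DFunLike.congr_fun hcomp v)).trans
    (DFunLike.congr_fun hpt _).symm

/-- The exterior derivative commutes with pull-back along the transition map `Ψ ∘ e.symm`, and the
chain rule turns the derivative of that map, composed with that of the preferred chart, into
`coordDeriv Ψ`. -/
theorem IsLocalCoords.extDerivForm_eq (hc : IsLocalCoords I Φ Ψ x)
    {η : ∀ x : M, TangentSpace I x →L[ℝ] ℝ} {ζ : F → F →L[ℝ] ℝ}
    (hηζ : pullForm I η Φ =ᶠ[𝓝 (Ψ x)] ζ) (hζ : DifferentiableAt ℝ ζ (Ψ x))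
    (u w : TangentSpace I x) :
    extDerivForm I η x u w =
      fderiv ℝ ζ (Ψ x) (coordDeriv I Ψ x u) (coordDeriv I Ψ x w) -
        fderiv ℝ ζ (Ψ x) (coordDeriv I Ψ x w) (coordDeriv I Ψ x u) := by
  have : IsManifold I 1 M := IsManifold.of_le (n := ∞) (by simp)
  have hex : (extChartAt I x).symm (extChartAt I x x) = x := extChartAt_to_inv x
  have hs : ContMDiffAt 𝓘(ℝ, E) I ∞ (extChartAt I x).symm (extChartAt I x x) :=
    (contMDiffOn_extChartAt_symm x).contMDiffAt (extChartAt_target_mem_nhds x)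
  have hg : ContDiffAt ℝ ∞ (Ψ ∘ (extChartAt I x).symm) (extChartAt I x x) := by
    refine contMDiffAt_iff_contDiffAt.1 (ContMDiffAt.comp _ ?_ hs)
    rw [hex]; exact hc.contMDiffAt
  have hgx : (Ψ ∘ (extChartAt I x).symm) (extChartAt I x x) = Ψ x := by
    rw [Function.comp_apply, hex]
  have hderiv : ∀ v : TangentSpace I x, fderiv ℝ (Ψ ∘ (extChartAt I x).symm) (extChartAt I x x)
      (mfderiv I 𝓘(ℝ, E) (extChartAt I x) x v) = coordDeriv I Ψ x v := by
    intro v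
    have hd := (hg.differentiableAt (by simp)).mdifferentiableAt
    have hcomp := mfderiv_comp x hd (mdifferentiableAt_extChartAt (mem_chart_source H x))
    have heq : (Ψ ∘ (extChartAt I x).symm) ∘ extChartAt I x =ᶠ[𝓝 x] Ψ := by
      filter_upwards [extChartAt_source_mem_nhds (I := I) x] with z hz
      exact congrArg Ψ ((extChartAt I x).left_inv hz)
    rw [heq.mfderiv_eq, mfderiv_eq_fderiv] at hcomp
    exact (DFunLike.congr_fun hcomp v).symm
  have hζ' : DifferentiableAt ℝ
      (fun y => ContinuousAlternatingMap.ofSubsingleton ℝ F ℝ (0 : Fin 1) (ζ y))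
      ((Ψ ∘ (extChartAt I x).symm) (extChartAt I x x)) := by
    rw [hgx]
    exact ((ContinuousAlternatingMap.ofSubsingletonLIE (𝕜 := ℝ) (E := F) (F := ℝ)
        (0 : Fin 1)).toContinuousLinearEquiv.differentiableAt).comp (Ψ x) hζ
  have hpull := extDeriv_pullback hζ' hg (r := ∞)
    (by simpa using (mod_cast le_top : ((2 : ℕ∞) : WithTop ℕ∞) ≤ ∞))
  have hev : (fun y => ContinuousAlternatingMap.ofSubsingleton ℝ E ℝ (0 : Fin 1)
      (formInChart I η x y)) =ᶠ[𝓝 (extChartAt I x x)] fun y =>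
      (ContinuousAlternatingMap.ofSubsingleton ℝ F ℝ (0 : Fin 1)
        (ζ ((Ψ ∘ (extChartAt I x).symm) y))).compContinuousLinearMap
          (fderiv ℝ (Ψ ∘ (extChartAt I x).symm) y) := by
    filter_upwards [hc.formInChart_eventuallyEq hηζ] with y hy
    rw [hy]; ext v; simp
  rw [extDerivForm, hev.extDeriv_eq, hpull, hgx, ← extDeriv_ofSubsingleton_apply hζ, ← hderiv u,
    ← hderiv w]
  rw [ContinuousAlternatingMap.compContinuousLinearMap_apply]
  congr 1
  ext i
  fin_cases i <;> rfl

end LocalCoordinates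

/-! ### Natural coordinates -/

section NaturalCoordinates

variable {n k : ℕ} {Q : Type*} [TopologicalSpace Q] [ChartedSpace (EuclideanSpace ℝ (Fin n)) Q]
  [IsManifold (𝓡 n) ∞ Q]

/-- The derivative of a chart, with the tangent spaces unfolded. -/
def chartDeriv (c : OpenPartialHomeomorph Q (EuclideanSpace ℝ (Fin n))) (q : Q) :
    EuclideanSpace ℝ (Fin n) →L[ℝ] EuclideanSpace ℝ (Fin n) := mfderiv (𝓡 n) (𝓡 n) c q

/-- The derivative of an inverse chart, with the tangent spaces unfolded. -/
def chartSymmDeriv (c : OpenPartialHomeomorph Q (EuclideanSpace ℝ (Fin n)))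
    (y : EuclideanSpace ℝ (Fin n)) :
    EuclideanSpace ℝ (Fin n) →L[ℝ] EuclideanSpace ℝ (Fin n) := mfderiv (𝓡 n) (𝓡 n) c.symm y

variable {c c' : OpenPartialHomeomorph Q (EuclideanSpace ℝ (Fin n))}

omit [IsManifold (𝓡 n) ∞ Q] in
theorem mdifferentiable_chart_of_mem (hc : c ∈ IsManifold.maximalAtlas (𝓡 n) ∞ Q) :
    c.MDifferentiable (𝓡 n) (𝓡 n) :=
  ⟨(contMDiffOn_of_mem_maximalAtlas hc).mdifferentiableOn (by simp),
    (contMDiffOn_symm_of_mem_maximalAtlas hc).mdifferentiableOn (by simp)⟩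

omit [IsManifold (𝓡 n) ∞ Q] in
theorem chartSymmDeriv_comp_chartDeriv (hc : c ∈ IsManifold.maximalAtlas (𝓡 n) ∞ Q) {q : Q}
    (hq : q ∈ c.source) :
    chartSymmDeriv c (c q) ∘L chartDeriv c q = ContinuousLinearMap.id ℝ _ :=
  (mdifferentiable_chart_of_mem hc).symm_comp_deriv hq

omit [IsManifold (𝓡 n) ∞ Q] in
theorem chartDeriv_comp_chartSymmDeriv (hc : c ∈ IsManifold.maximalAtlas (𝓡 n) ∞ Q)
    {y : EuclideanSpace ℝ (Fin n)} (hy : y ∈ c.target) :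
    chartDeriv c (c.symm y) ∘L chartSymmDeriv c y = ContinuousLinearMap.id ℝ _ :=
  (mdifferentiable_chart_of_mem hc).comp_symm_deriv hy

omit [IsManifold (𝓡 n) ∞ Q] in
theorem fderiv_chart_trans (hc : c ∈ IsManifold.maximalAtlas (𝓡 n) ∞ Q)
    (hc' : c' ∈ IsManifold.maximalAtlas (𝓡 n) ∞ Q) {y : EuclideanSpace ℝ (Fin n)}
    (hy : y ∈ c.target) (hy' : c.symm y ∈ c'.source) :
    fderiv ℝ (c' ∘ c.symm) y = chartDeriv c' (c.symm y) ∘L chartSymmDeriv c y := by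
  rw [← mfderiv_eq_fderiv]
  exact mfderiv_comp y ((mdifferentiable_chart_of_mem hc').mdifferentiableAt hy')
    ((mdifferentiable_chart_of_mem hc).mdifferentiableAt_symm hy)

omit [IsManifold (𝓡 n) ∞ Q] in
theorem contDiffAt_chart_trans (hc : c ∈ IsManifold.maximalAtlas (𝓡 n) ∞ Q)
    (hc' : c' ∈ IsManifold.maximalAtlas (𝓡 n) ∞ Q) {y : EuclideanSpace ℝ (Fin n)}
    (hy : y ∈ c.target) (hy' : c.symm y ∈ c'.source) :
    ContDiffAt ℝ ∞ (c' ∘ c.symm) y :=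
  contMDiffAt_iff_contDiffAt.1 <| ContMDiffAt.comp y (contMDiffAt_of_mem_maximalAtlas hc' hy')
    (contMDiffAt_symm_of_mem_maximalAtlas hc hy)

omit [IsManifold (𝓡 n) ∞ Q] in
theorem contDiffAt_fderiv_chart_trans (hc : c ∈ IsManifold.maximalAtlas (𝓡 n) ∞ Q)
    (hc' : c' ∈ IsManifold.maximalAtlas (𝓡 n) ∞ Q) {y : EuclideanSpace ℝ (Fin n)}
    (hy : y ∈ c.target) (hy' : c.symm y ∈ c'.source) :
    ContDiffAt ℝ ∞ (fderiv ℝ (c' ∘ c.symm)) y :=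
  (contDiffAt_chart_trans hc hc' hy hy').fderiv_right (by simp)

/-! ### Bundle trivializations in terms of chart derivatives -/

theorem continuousLinearMapAt_tangent (q₀ : Q) {q : Q}
    (hq : q ∈ (chartAt (EuclideanSpace ℝ (Fin n)) q₀).source) (u : EuclideanSpace ℝ (Fin n)) :
    (trivializationAt (EuclideanSpace ℝ (Fin n)) (TangentSpace (𝓡 n)) q₀).continuousLinearMapAt
      ℝ q u = chartDeriv (chartAt (EuclideanSpace ℝ (Fin n)) q₀) q u := by
  have : IsManifold (𝓡 n) 1 Q := IsManifold.of_le (n := ∞) (by simp)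
  exact DFunLike.congr_fun (TangentBundle.continuousLinearMapAt_trivializationAt hq) u

theorem symmL_tangent (q₀ : Q) {q : Q}
    (hq : q ∈ (chartAt (EuclideanSpace ℝ (Fin n)) q₀).source) (u : EuclideanSpace ℝ (Fin n)) :
    (trivializationAt (EuclideanSpace ℝ (Fin n)) (TangentSpace (𝓡 n)) q₀).symmL ℝ q u =
      chartSymmDeriv (chartAt (EuclideanSpace ℝ (Fin n)) q₀)
        (chartAt (EuclideanSpace ℝ (Fin n)) q₀ q) u := by
  have : IsManifold (𝓡 n) 1 Q := IsManifold.of_le (n := ∞) (by simp)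
  have h := TangentBundle.symmL_trivializationAt (I := 𝓡 n) hq
  rw [ModelWithCorners.range_eq_univ, mfderivWithin_univ] at h
  exact DFunLike.congr_fun h u

/-- A Hom bundle is trivialized by conjugation; on the trivial factor `ℝ^k` this is the identity, so
only the derivative of the chart of `Q` remains. -/
theorem trivializationAt_velFibre_snd (q₀ : Q) {q : Q}
    (hq : q ∈ (chartAt (EuclideanSpace ℝ (Fin n)) q₀).source) (v : VelModel n k) :
    (trivializationAt (VelModel n k) (VelFibre n k Q) q₀ ⟨q, v⟩).2 =
      chartDeriv (chartAt (EuclideanSpace ℝ (Fin n)) q₀) q ∘L v := by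
  have h0 : (trivializationAt (Fin k → ℝ) (Bundle.Trivial Q (Fin k → ℝ)) q₀).symmL ℝ q =
    ContinuousLinearMap.id ℝ _ := Bundle.Trivial.symmL_trivialization ℝ Q (Fin k → ℝ) q
  ext1 w
  refine Eq.trans (?_ : _ = (trivializationAt (EuclideanSpace ℝ (Fin n))
    (TangentSpace (𝓡 n)) q₀).continuousLinearMapAt ℝ q (v w)) (continuousLinearMapAt_tangent q₀ hq _)
  exact congrArg (fun A : (Fin k → ℝ) →L[ℝ] (Fin k → ℝ) => (trivializationAt
    (EuclideanSpace ℝ (Fin n)) (TangentSpace (𝓡 n)) q₀).continuousLinearMapAt ℝ q (v (A w))) h0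

theorem trivializationAt_momFibre_snd (q₀ : Q) {q : Q}
    (hq : q ∈ (chartAt (EuclideanSpace ℝ (Fin n)) q₀).source) (p : MomModel n k) :
    (trivializationAt (MomModel n k) (MomFibre n k Q) q₀ ⟨q, p⟩).2 =
      p ∘L chartSymmDeriv (chartAt (EuclideanSpace ℝ (Fin n)) q₀)
        (chartAt (EuclideanSpace ℝ (Fin n)) q₀ q) := by
  have h0 : (trivializationAt (Fin k → ℝ) (Bundle.Trivial Q (Fin k → ℝ)) q₀).continuousLinearMapAt
    ℝ q = ContinuousLinearMap.id ℝ _ :=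
      Bundle.Trivial.continuousLinearMapAt_trivialization ℝ Q (Fin k → ℝ) q
  ext1 w
  refine Eq.trans (?_ : _ = p ((trivializationAt (EuclideanSpace ℝ (Fin n))
    (TangentSpace (𝓡 n)) q₀).symmL ℝ q w)) (congrArg p (symmL_tangent q₀ hq _))
  exact congrArg (fun A : (Fin k → ℝ) →L[ℝ] (Fin k → ℝ) => A (p ((trivializationAt
    (EuclideanSpace ℝ (Fin n)) (TangentSpace (𝓡 n)) q₀).symmL ℝ q w))) h0

/-- The point of the extended Pontryagin bundle with given components. -/
def pontMk (q : Q) (v : VelModel n k) (p : MomModel n k) (s : Fin k → ℝ) : Pontryagin n k Q :=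
  (⟨q, (v, p)⟩, s)

/-- The base point of an element of the extended Pontryagin bundle. -/
def pontBase (w : Pontryagin n k Q) : Q := w.1.proj

/-- The velocities of an element of the extended Pontryagin bundle. -/
def pontVel (w : Pontryagin n k Q) : VelModel n k := w.1.snd.1

/-- The momenta of an element of the extended Pontryagin bundle. -/
def pontMom (w : Pontryagin n k Q) : MomModel n k := w.1.snd.2

/-- The natural coordinates `(q^i, v^i_α, p_i^α, s^α)` of the extended Pontryagin bundle. -/
def pontToCoords (c : OpenPartialHomeomorph Q (EuclideanSpace ℝ (Fin n)))
    (w : Pontryagin n k Q) :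
    EuclideanSpace ℝ (Fin n) × VelModel n k × MomModel n k × (Fin k → ℝ) :=
  (c (pontBase w), chartDeriv c (pontBase w) ∘L pontVel w,
    pontMom w ∘L chartSymmDeriv c (c (pontBase w)), w.2)

/-- Inverse of the natural coordinates of the extended Pontryagin bundle. -/
def pontFromCoords (c : OpenPartialHomeomorph Q (EuclideanSpace ℝ (Fin n)))
    (y : EuclideanSpace ℝ (Fin n) × VelModel n k × MomModel n k × (Fin k → ℝ)) :
    Pontryagin n k Q :=
  pontMk (c.symm y.1) (chartSymmDeriv c y.1 ∘L y.2.1) (y.2.2.1 ∘L chartDeriv c (c.symm y.1)) y.2.2.2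

omit [IsManifold (𝓡 n) ∞ Q] in
theorem toCoords_eq (x : LagSpace n k Q) :
    toCoords c x = (c (tauQ x), chartDeriv c (tauQ x) ∘L velocities x, x.2) := rfl

omit [IsManifold (𝓡 n) ∞ Q] in
theorem fromCoords_eq (y : EuclideanSpace ℝ (Fin n) × VelModel n k × (Fin k → ℝ)) :
    (fromCoords c y : LagSpace n k Q) =
      fibreIncl (c.symm y.1) y.2.2 (chartSymmDeriv c y.1 ∘L y.2.1) := rfl

section

variable (hc : c ∈ IsManifold.maximalAtlas (𝓡 n) ∞ Q)
include hc

omit [IsManifold (𝓡 n) ∞ Q] in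
theorem toCoords_fromCoords {y : EuclideanSpace ℝ (Fin n) × VelModel n k × (Fin k → ℝ)}
    (hy : y.1 ∈ c.target) : toCoords c (fromCoords c y : LagSpace n k Q) = y := by
  obtain ⟨q, v, s⟩ := y
  have h1 : c (c.symm q) = q := c.right_inv hy
  have h2 : chartDeriv c (c.symm q) ∘L (chartSymmDeriv c q ∘L v) = v := by
    rw [← ContinuousLinearMap.comp_assoc, chartDeriv_comp_chartSymmDeriv hc hy]; rfl
  exact Prod.ext h1 (Prod.ext h2 rfl)

omit [IsManifold (𝓡 n) ∞ Q] in
theorem fromCoords_toCoords {x : LagSpace n k Q} (hx : tauQ x ∈ c.source) :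
    fromCoords c (toCoords c x) = x := by
  have h1 : c.symm (c (tauQ x)) = tauQ x := c.left_inv hx
  have h2 : chartSymmDeriv c (c (tauQ x)) ∘L (chartDeriv c (tauQ x) ∘L velocities x) =
      velocities x := by
    rw [← ContinuousLinearMap.comp_assoc, chartSymmDeriv_comp_chartDeriv hc hx]; rfl
  rw [fromCoords_eq, toCoords_eq]
  simp only [h1, h2]
  rfl

omit [IsManifold (𝓡 n) ∞ Q] in
theorem pontToCoords_pontFromCoords
    {y : EuclideanSpace ℝ (Fin n) × VelModel n k × MomModel n k × (Fin k → ℝ)}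
    (hy : y.1 ∈ c.target) : pontToCoords c (pontFromCoords c y : Pontryagin n k Q) = y := by
  obtain ⟨q, v, p, s⟩ := y
  have h1 : c (c.symm q) = q := c.right_inv hy
  have h2 : chartDeriv c (c.symm q) ∘L (chartSymmDeriv c q ∘L v) = v := by
    rw [← ContinuousLinearMap.comp_assoc, chartDeriv_comp_chartSymmDeriv hc hy]; rfl
  have h3 : (p ∘L chartDeriv c (c.symm q)) ∘L chartSymmDeriv c (c (c.symm q)) = p := by
    rw [h1, ContinuousLinearMap.comp_assoc, chartDeriv_comp_chartSymmDeriv hc hy]; rfl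
  exact Prod.ext h1 (Prod.ext h2 (Prod.ext h3 rfl))

omit [IsManifold (𝓡 n) ∞ Q] in
theorem pontFromCoords_pontToCoords {w : Pontryagin n k Q} (hw : pontBase w ∈ c.source) :
    pontFromCoords c (pontToCoords c w) = w := by
  have h1 : c.symm (c (pontBase w)) = pontBase w := c.left_inv hw
  have h2 : chartSymmDeriv c (c (pontBase w)) ∘L (chartDeriv c (pontBase w) ∘L pontVel w) =
      pontVel w := by
    rw [← ContinuousLinearMap.comp_assoc, chartSymmDeriv_comp_chartDeriv hc hw]; rfl
  have h3 : (pontMom w ∘L chartSymmDeriv c (c (pontBase w))) ∘L chartDeriv c (pontBase w) =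
      pontMom w := by
    rw [ContinuousLinearMap.comp_assoc, chartSymmDeriv_comp_chartDeriv hc hw]; rfl
  rw [pontFromCoords, pontToCoords]
  simp only [h1, h2, h3]
  rfl

/-! ### Smoothness of the natural coordinates -/

variable {G HG N : Type*} [NormedAddCommGroup G] [NormedSpace ℝ G]
  [TopologicalSpace HG] {J : ModelWithCorners ℝ G HG} [TopologicalSpace N] [ChartedSpace HG N]
  {f : N → Q} {a : N}

omit [IsManifold (𝓡 n) ∞ Q] in
theorem contMDiffAt_fderiv_chart_trans (hc' : c' ∈ IsManifold.maximalAtlas (𝓡 n) ∞ Q)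
    (hf : ContMDiffAt J (𝓡 n) ∞ f a) (ha : f a ∈ c.source) (ha' : f a ∈ c'.source) :
    ContMDiffAt J 𝓘(ℝ, EuclideanSpace ℝ (Fin n) →L[ℝ] EuclideanSpace ℝ (Fin n)) ∞
      (fun z => fderiv ℝ (c' ∘ c.symm) (c (f z))) a := by
  have h1 := contDiffAt_fderiv_chart_trans hc hc' (c.map_source ha) (by rwa [c.left_inv ha])
  exact h1.contMDiffAt.comp a
    (ContMDiffAt.comp a (contMDiffAt_of_mem_maximalAtlas hc ha) hf)

-- Changing charts composes the velocities on the left with the derivative of `c' ∘ c.symm`, which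
-- is smooth along `f`. Momenta are instead composed on the right with the derivative of the inverse
-- transition.
omit [IsManifold (𝓡 n) ∞ Q] in
theorem contMDiffAt_vel_change_chart (hc' : c' ∈ IsManifold.maximalAtlas (𝓡 n) ∞ Q)
    (hf : ContMDiffAt J (𝓡 n) ∞ f a) (ha : f a ∈ c.source) (ha' : f a ∈ c'.source)
    {v : N → VelModel n k}
    (hv : ContMDiffAt J 𝓘(ℝ, VelModel n k) ∞ (fun z => chartDeriv c (f z) ∘L v z) a) :
    ContMDiffAt J 𝓘(ℝ, VelModel n k) ∞ (fun z => chartDeriv c' (f z) ∘L v z) a := by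
  refine ((contMDiffAt_fderiv_chart_trans hc hc' hf ha ha').clm_comp hv).congr_of_eventuallyEq ?_
  filter_upwards [hf.continuousAt.preimage_mem_nhds (c.open_source.mem_nhds ha),
    hf.continuousAt.preimage_mem_nhds (c'.open_source.mem_nhds ha')] with z hz hz'
  have hz1 : f z ∈ c.source := hz
  have hz2 : f z ∈ c'.source := hz'
  rw [fderiv_chart_trans hc hc' (c.map_source hz1) (by rwa [c.left_inv hz1]), c.left_inv hz1,
    ContinuousLinearMap.comp_assoc, ← ContinuousLinearMap.comp_assoc (chartSymmDeriv c _),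
    chartSymmDeriv_comp_chartDeriv hc hz1, ContinuousLinearMap.id_comp]

omit [IsManifold (𝓡 n) ∞ Q] in
theorem contMDiffAt_mom_change_chart (hc' : c' ∈ IsManifold.maximalAtlas (𝓡 n) ∞ Q)
    (hf : ContMDiffAt J (𝓡 n) ∞ f a) (ha : f a ∈ c.source) (ha' : f a ∈ c'.source)
    {p : N → MomModel n k}
    (hp : ContMDiffAt J 𝓘(ℝ, MomModel n k) ∞ (fun z => p z ∘L chartSymmDeriv c (c (f z))) a) :
    ContMDiffAt J 𝓘(ℝ, MomModel n k) ∞ (fun z => p z ∘L chartSymmDeriv c' (c' (f z))) a := by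
  refine (hp.clm_comp (contMDiffAt_fderiv_chart_trans hc' hc hf ha' ha)).congr_of_eventuallyEq ?_
  filter_upwards [hf.continuousAt.preimage_mem_nhds (c.open_source.mem_nhds ha),
    hf.continuousAt.preimage_mem_nhds (c'.open_source.mem_nhds ha')] with z hz hz'
  have hz1 : f z ∈ c.source := hz
  have hz2 : f z ∈ c'.source := hz'
  rw [fderiv_chart_trans hc' hc (c'.map_source hz2) (by rwa [c'.left_inv hz2]), c'.left_inv hz2,
    ContinuousLinearMap.comp_assoc, ← ContinuousLinearMap.comp_assoc (chartSymmDeriv c _),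
    chartSymmDeriv_comp_chartDeriv hc hz1, ContinuousLinearMap.id_comp]

/-- Smoothness into the total space is tested in the trivialization of the preferred chart; this
replaces that chart by any chart of the maximal atlas. -/
theorem contMDiffAt_velFibre_iff (hf : ContMDiffAt J (𝓡 n) ∞ f a) (ha : f a ∈ c.source)
    {v : N → VelModel n k} :
    ContMDiffAt J 𝓘(ℝ, VelModel n k) ∞
        (fun z => (trivializationAt (VelModel n k) (VelFibre n k Q) (f a) ⟨f z, v z⟩).2) a ↔
      ContMDiffAt J 𝓘(ℝ, VelModel n k) ∞ (fun z => chartDeriv c (f z) ∘L v z) a := by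
  have hc₀ := IsManifold.chart_mem_maximalAtlas (I := 𝓡 n) (n := ∞) (f a)
  have ha₀ := mem_chart_source (EuclideanSpace ℝ (Fin n)) (f a)
  have heq : (fun z => (trivializationAt (VelModel n k) (VelFibre n k Q) (f a) ⟨f z, v z⟩).2)
      =ᶠ[𝓝 a] fun z => chartDeriv (chartAt (EuclideanSpace ℝ (Fin n)) (f a)) (f z) ∘L v z := by
    filter_upwards [hf.continuousAt.preimage_mem_nhds ((chartAt (EuclideanSpace ℝ (Fin n))
      (f a)).open_source.mem_nhds ha₀)] with z hz
    exact trivializationAt_velFibre_snd (f a) hz (v z)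
  rw [heq.contMDiffAt_iff]
  exact ⟨contMDiffAt_vel_change_chart hc₀ hc hf ha₀ ha,
    contMDiffAt_vel_change_chart hc hc₀ hf ha ha₀⟩

theorem contMDiffAt_momFibre_iff (hf : ContMDiffAt J (𝓡 n) ∞ f a) (ha : f a ∈ c.source)
    {p : N → MomModel n k} :
    ContMDiffAt J 𝓘(ℝ, MomModel n k) ∞
        (fun z => (trivializationAt (MomModel n k) (MomFibre n k Q) (f a) ⟨f z, p z⟩).2) a ↔
      ContMDiffAt J 𝓘(ℝ, MomModel n k) ∞ (fun z => p z ∘L chartSymmDeriv c (c (f z))) a := by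
  have hc₀ := IsManifold.chart_mem_maximalAtlas (I := 𝓡 n) (n := ∞) (f a)
  have ha₀ := mem_chart_source (EuclideanSpace ℝ (Fin n)) (f a)
  have heq : (fun z => (trivializationAt (MomModel n k) (MomFibre n k Q) (f a) ⟨f z, p z⟩).2)
      =ᶠ[𝓝 a] fun z => p z ∘L chartSymmDeriv (chartAt (EuclideanSpace ℝ (Fin n)) (f a))
        (chartAt (EuclideanSpace ℝ (Fin n)) (f a) (f z)) := by
    filter_upwards [hf.continuousAt.preimage_mem_nhds ((chartAt (EuclideanSpace ℝ (Fin n))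
      (f a)).open_source.mem_nhds ha₀)] with z hz
    exact trivializationAt_momFibre_snd (f a) hz (p z)
  rw [heq.contMDiffAt_iff]
  exact ⟨contMDiffAt_mom_change_chart hc₀ hc hf ha₀ ha,
    contMDiffAt_mom_change_chart hc hc₀ hf ha ha₀⟩

/-- The fibre part of the parametrization, read in the chart `c`, is just a coordinate projection,
because going to the bundle and back is the identity over the target of `c`. -/
theorem isLocalCoords_lag {x : LagSpace n k Q} (hx : tauQ x ∈ c.source) :
    IsLocalCoords (lagI n k) (fromCoords c) (toCoords c) x where
  contMDiffAt_symm := by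
    have hb : ContMDiffAt 𝓘(ℝ, EuclideanSpace ℝ (Fin n) × VelModel n k × (Fin k → ℝ)) (𝓡 n) ∞
        (fun y => c.symm y.1) (toCoords c x) :=
      ContMDiffAt.comp _ (contMDiffAt_symm_of_mem_maximalAtlas hc (c.map_source hx))
        contDiff_fst.contMDiff.contMDiffAt
    have hb' : c.symm (toCoords c x).1 ∈ c.source := by rwa [toCoords_eq, c.left_inv hx]
    refine ContMDiffAt.prodMk (f := fun y => (fromCoords c y : LagSpace n k Q).1)
      (g := fun y => (fromCoords c y : LagSpace n k Q).2)
      (Bundle.contMDiffAt_totalSpace.2 ⟨hb, ?_⟩) ?_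
    · refine (contMDiffAt_velFibre_iff hc hb hb').2 ?_
      have h1 : ContMDiffAt 𝓘(ℝ, EuclideanSpace ℝ (Fin n) × VelModel n k × (Fin k → ℝ))
        𝓘(ℝ, VelModel n k) ∞ (fun y => y.2.1) (toCoords c x) :=
        (contDiff_fst.comp contDiff_snd).contMDiff.contMDiffAt
      refine h1.congr_of_eventuallyEq ?_
      filter_upwards [continuousAt_fst.preimage_mem_nhds
        (c.open_target.mem_nhds (c.map_source hx))] with y hy
      exact congrArg (fun z => z.2.1) (toCoords_fromCoords hc hy)
    · exact (contDiff_snd.comp contDiff_snd).contMDiff.contMDiffAt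
  contMDiffAt := by
    have h0 : ContMDiffAt (lagI n k) ((𝓡 n).prod 𝓘(ℝ, VelModel n k)) ∞
      (fun x : LagSpace n k Q => x.1) x := contMDiffAt_fst
    have h1 := Bundle.contMDiffAt_totalSpace.1 h0
    refine ContMDiffAt.prodMk_space ?_ (ContMDiffAt.prodMk_space ?_ contMDiffAt_snd)
    · exact ContMDiffAt.comp x (contMDiffAt_of_mem_maximalAtlas hc hx) h1.1
    · exact (contMDiffAt_velFibre_iff hc h1.1 hx).1 h1.2
  left_inv := by
    filter_upwards [continuousAt_fst.preimage_mem_nhds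
      (c.open_target.mem_nhds (c.map_source hx))] with y hy
    exact toCoords_fromCoords hc hy
  right_inv := by
    have h0 : ContMDiffAt (lagI n k) ((𝓡 n).prod 𝓘(ℝ, VelModel n k)) ∞
      (fun x : LagSpace n k Q => x.1) x := contMDiffAt_fst
    filter_upwards [(Bundle.contMDiffAt_totalSpace.1 h0).1.continuousAt.preimage_mem_nhds
      (c.open_source.mem_nhds hx)] with y hy
    exact fromCoords_toCoords hc hy

theorem isLocalCoords_pont {w : Pontryagin n k Q} (hw : pontBase w ∈ c.source) :
    IsLocalCoords (pontI n k) (pontFromCoords c) (pontToCoords c) w where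
  contMDiffAt_symm := by
    have hb : ContMDiffAt
        𝓘(ℝ, EuclideanSpace ℝ (Fin n) × VelModel n k × MomModel n k × (Fin k → ℝ)) (𝓡 n) ∞
        (fun y => c.symm y.1) (pontToCoords c w) :=
      ContMDiffAt.comp _ (contMDiffAt_symm_of_mem_maximalAtlas hc (c.map_source hw))
        contDiff_fst.contMDiff.contMDiffAt
    have hb' : c.symm (pontToCoords c w).1 ∈ c.source := by rwa [pontToCoords, c.left_inv hw]
    have hev : ∀ᶠ y in 𝓝 (pontToCoords c w), pontToCoords c (pontFromCoords c y) = y := by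
      filter_upwards [continuousAt_fst.preimage_mem_nhds
        (c.open_target.mem_nhds (c.map_source hw))] with y hy
      exact pontToCoords_pontFromCoords hc hy
    refine ContMDiffAt.prodMk (f := fun y => (pontFromCoords c y : Pontryagin n k Q).1)
      (g := fun y => (pontFromCoords c y : Pontryagin n k Q).2)
      (Bundle.contMDiffAt_totalSpace.2 ⟨hb, ContMDiffAt.prodMk_space ?_ ?_⟩) ?_
    · refine (contMDiffAt_velFibre_iff hc hb hb').2 ?_
      have h1 : ContMDiffAt
        𝓘(ℝ, EuclideanSpace ℝ (Fin n) × VelModel n k × MomModel n k × (Fin k → ℝ))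
        𝓘(ℝ, VelModel n k) ∞ (fun y => y.2.1) (pontToCoords c w) :=
        (contDiff_fst.comp contDiff_snd).contMDiff.contMDiffAt
      refine h1.congr_of_eventuallyEq ?_
      filter_upwards [hev] with y hy using congrArg (fun z => z.2.1) hy
    · refine (contMDiffAt_momFibre_iff hc hb hb').2 ?_
      have h1 : ContMDiffAt
        𝓘(ℝ, EuclideanSpace ℝ (Fin n) × VelModel n k × MomModel n k × (Fin k → ℝ))
        𝓘(ℝ, MomModel n k) ∞ (fun y => y.2.2.1) (pontToCoords c w) :=
        (contDiff_fst.comp (contDiff_snd.comp contDiff_snd)).contMDiff.contMDiffAt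
      refine h1.congr_of_eventuallyEq ?_
      filter_upwards [hev] with y hy using congrArg (fun z => z.2.2.1) hy
    · exact (contDiff_snd.comp (contDiff_snd.comp contDiff_snd)).contMDiff.contMDiffAt
  contMDiffAt := by
    have h0 : ContMDiffAt (pontI n k) ((𝓡 n).prod 𝓘(ℝ, VelModel n k × MomModel n k)) ∞
      (fun x : Pontryagin n k Q => x.1) w := contMDiffAt_fst
    have h1 := Bundle.contMDiffAt_totalSpace.1 h0
    have h2 := (ContinuousLinearMap.fst ℝ (VelModel n k) (MomModel n k)).contMDiff.contMDiffAt.comp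
      w h1.2
    have h3 := (ContinuousLinearMap.snd ℝ (VelModel n k) (MomModel n k)).contMDiff.contMDiffAt.comp
      w h1.2
    refine ContMDiffAt.prodMk_space ?_ (ContMDiffAt.prodMk_space ?_
      (ContMDiffAt.prodMk_space ?_ contMDiffAt_snd))
    · exact ContMDiffAt.comp w (contMDiffAt_of_mem_maximalAtlas hc hw) h1.1
    · exact (contMDiffAt_velFibre_iff hc h1.1 hw).1 h2
    · exact (contMDiffAt_momFibre_iff hc h1.1 hw).1 h3
  left_inv := by
    filter_upwards [continuousAt_fst.preimage_mem_nhds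
      (c.open_target.mem_nhds (c.map_source hw))] with y hy
    exact pontToCoords_pontFromCoords hc hy
  right_inv := by
    have h0 : ContMDiffAt (pontI n k) ((𝓡 n).prod 𝓘(ℝ, VelModel n k × MomModel n k)) ∞
      (fun x : Pontryagin n k Q => x.1) w := contMDiffAt_fst
    filter_upwards [(Bundle.contMDiffAt_totalSpace.1 h0).1.continuousAt.preimage_mem_nhds
      (c.open_source.mem_nhds hw)] with y hy
    exact pontFromCoords_pontToCoords hc hy

end

end NaturalCoordinates

/-! ### Lagrangian functions in a vector space -/

section VectorSpace

variable (n k : ℕ)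

/-- The space of natural coordinates of `⊕^k TQ × ℝ^k`. -/
abbrev LagCoords := EuclideanSpace ℝ (Fin n) × VelModel n k × (Fin k → ℝ)

/-- The space of natural coordinates of the extended Pontryagin bundle. -/
abbrev PontCoords := EuclideanSpace ℝ (Fin n) × VelModel n k × MomModel n k × (Fin k → ℝ)

variable {n k}

/-- The inclusion of the `α`-th velocity. -/
def velSlot (α : Fin k) : EuclideanSpace ℝ (Fin n) →L[ℝ] LagCoords n k :=
  (0 : EuclideanSpace ℝ (Fin n) →L[ℝ] EuclideanSpace ℝ (Fin n)).prod
    ((ContinuousLinearMap.smulRightL ℝ (Fin k → ℝ) (EuclideanSpace ℝ (Fin n))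
      (ContinuousLinearMap.proj (R := ℝ) (φ := fun _ : Fin k => ℝ) α)).prod 0)

/-- The momenta `∂L/∂v_α` of a Lagrangian function in coordinates. -/
def coordMomentum (l : LagCoords n k → ℝ) (α : Fin k) (y : LagCoords n k) :
    EuclideanSpace ℝ (Fin n) →L[ℝ] ℝ :=
  fderiv ℝ l y ∘L velSlot α

theorem velSlot_apply (α : Fin k) (z : EuclideanSpace ℝ (Fin n)) :
    (velSlot α z : LagCoords n k) = (0, ContinuousLinearMap.smulRight
      (ContinuousLinearMap.proj (R := ℝ) (φ := fun _ : Fin k => ℝ) α) z, 0) := rfl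

theorem sum_velSlot (V : VelModel n k) :
    ∑ α, velSlot α (V (Pi.single α 1)) = ((0, V, 0) : LagCoords n k) := by
  simp only [velSlot_apply]
  refine Prod.ext (by simp [Prod.fst_sum]) (Prod.ext ?_ (by simp [Prod.snd_sum]))
  simp only [Prod.snd_sum, Prod.fst_sum]
  ext1 w
  simp only [sum_apply, ContinuousLinearMap.smulRight_apply,
    ContinuousLinearMap.proj_apply]
  conv_rhs => rw [← Finset.univ_sum_single w, map_sum]
  refine Finset.sum_congr rfl fun α _ => ?_
  rw [← map_smul, ← Pi.single_smul, smul_eq_mul, mul_one]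

theorem sum_coordMomentum (l : LagCoords n k → ℝ) (y : LagCoords n k) (V : VelModel n k) :
    ∑ α, coordMomentum l α y (V (Pi.single α 1)) = fderiv ℝ l y (0, V, 0) := by
  rw [← sum_velSlot, map_sum]; rfl

end VectorSpace

/-! ### The geometric objects in natural coordinates -/

section Expressions

variable {n k : ℕ} {Q : Type*} [TopologicalSpace Q] [ChartedSpace (EuclideanSpace ℝ (Fin n)) Q]
  [IsManifold (𝓡 n) ∞ Q]
  {c : OpenPartialHomeomorph Q (EuclideanSpace ℝ (Fin n))}
  (hc : c ∈ IsManifold.maximalAtlas (𝓡 n) ∞ Q)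

theorem contMDiff_pontBase :
    ContMDiff (pontI n k) (𝓡 n) ∞ (pontBase : Pontryagin n k Q → Q) :=
  (Bundle.contMDiff_proj (VelFibre n k Q ×ᵇ MomFibre n k Q)).comp contMDiff_fst

theorem contMDiff_tauQ : ContMDiff (lagI n k) (𝓡 n) ∞ (tauQ : LagSpace n k Q → Q) :=
  (Bundle.contMDiff_proj (VelFibre n k Q)).comp contMDiff_fst

theorem mdifferentiable_rho2 :
    MDifferentiable (pontI n k) (hamI n k) (rho2 : Pontryagin n k Q → HamSpace n k Q) := by
  intro w
  have h0 : ContMDiffAt (pontI n k) ((𝓡 n).prod 𝓘(ℝ, VelModel n k × MomModel n k)) ∞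
    (fun x : Pontryagin n k Q => x.1) w := contMDiffAt_fst
  have h1 := Bundle.contMDiffAt_totalSpace.1 h0
  have h2' := (ContinuousLinearMap.snd ℝ (VelModel n k) (MomModel n k)).contMDiff.contMDiffAt.comp
    w h1.2
  have h2 : ContMDiffAt (pontI n k) ((𝓡 n).prod 𝓘(ℝ, MomModel n k)) ∞
      (fun x : Pontryagin n k Q => (rho2 x).1) w :=
    Bundle.contMDiffAt_totalSpace.2 ⟨h1.1, h2'⟩
  have h3 : ContMDiffAt (pontI n k) (hamI n k) ∞
      (rho2 : Pontryagin n k Q → HamSpace n k Q) w := h2.prodMk contMDiffAt_snd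
  exact h3.mdifferentiableAt (by simp)

theorem contMDiff_piQ : ContMDiff (hamI n k) (𝓡 n) ∞ (piQ : HamSpace n k Q → Q) :=
  (Bundle.contMDiff_proj (MomFibre n k Q)).comp contMDiff_fst

include hc

omit [IsManifold (𝓡 n) ∞ Q] in
theorem chartDeriv_mfderiv {E H M : Type*} [NormedAddCommGroup E] [NormedSpace ℝ E]
    [TopologicalSpace H] {I : ModelWithCorners ℝ E H} [TopologicalSpace M] [ChartedSpace H M]
    {f : M → Q} {x : M} (hf : MDifferentiableAt I (𝓡 n) f x) (hx : f x ∈ c.source)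
    (u : TangentSpace I x) :
    chartDeriv c (f x) (mfderiv I (𝓡 n) f x u) = coordDeriv I (fun z => c (f z)) x u :=
  (DFunLike.congr_fun
    (mfderiv_comp x ((mdifferentiable_chart_of_mem hc).mdifferentiableAt hx) hf) u).symm

theorem chartDeriv_mfderiv_pontBase {w : Pontryagin n k Q} (hw : pontBase w ∈ c.source)
    (u : TangentSpace (pontI n k) w) :
    chartDeriv c (pontBase w) (mfderiv (pontI n k) (𝓡 n) pontBase w u) =
      (coordDeriv (pontI n k) (pontToCoords c) w u).1 := by
  rw [chartDeriv_mfderiv hc (contMDiff_pontBase.mdifferentiableAt (by simp)) hw]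
  let A : PontCoords n k →L[ℝ] EuclideanSpace ℝ (Fin n) := ContinuousLinearMap.fst ℝ _ _
  have h3 := mfderiv_comp w (A.differentiableAt (x := pontToCoords c w)).mdifferentiableAt
    (isLocalCoords_pont hc hw).mdifferentiableAt
  rw [mfderiv_eq_fderiv, A.fderiv] at h3
  exact DFunLike.congr_fun h3 u

/-- This is `ds^α - p_i^α dq^i`: momenta are read with the inverse chart derivative and base vectors
with the chart derivative, so the two cancel in `p^α (Tπ u)`. -/
theorem contactForm_apply {w : Pontryagin n k Q} (hw : pontBase w ∈ c.source) (α : Fin k)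
    (u : TangentSpace (pontI n k) w) :
    contactForm α w u = (coordDeriv (pontI n k) (pontToCoords c) w u).2.2.2 α -
      (pontToCoords c w).2.2.1 (coordDeriv (pontI n k) (pontToCoords c) w u).1 α := by
  have hΨ := (isLocalCoords_pont hc hw).mdifferentiableAt
  have h1 : differential (pontI n k) (fun y : Pontryagin n k Q => y.2 α) w u =
      (coordDeriv (pontI n k) (pontToCoords c) w u).2.2.2 α := by
    let A : (EuclideanSpace ℝ (Fin n) × VelModel n k × MomModel n k × (Fin k → ℝ)) →L[ℝ] ℝ :=
      ContinuousLinearMap.proj (R := ℝ) (φ := fun _ : Fin k => ℝ) α ∘L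
        ContinuousLinearMap.snd ℝ _ _ ∘L ContinuousLinearMap.snd ℝ _ _ ∘L
          ContinuousLinearMap.snd ℝ _ _
    have h := differential_eq_of_eventuallyEq (g := A) (h := fun y : Pontryagin n k Q => y.2 α) hΨ
      A.differentiableAt (Eventually.of_forall fun _ => rfl) u
    rw [A.fderiv] at h
    exact h
  have h2 := chartDeriv_mfderiv_pontBase hc hw u
  have h3 : mfderiv (pontI n k) (𝓡 n) pontBase w u =
      mfderiv (hamI n k) (𝓡 n) piQ (rho2 w) (mfderiv (pontI n k) (hamI n k) rho2 w u) :=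
    DFunLike.congr_fun (mfderiv_comp w (contMDiff_piQ.mdifferentiableAt (by simp))
      (mdifferentiable_rho2 w)) u
  have h4 : (pontToCoords c w).2.2.1 (chartDeriv c (pontBase w)
      (mfderiv (pontI n k) (𝓡 n) pontBase w u)) =
      pontMom w (mfderiv (pontI n k) (𝓡 n) pontBase w u) :=
    congrArg (pontMom w) (DFunLike.congr_fun (chartSymmDeriv_comp_chartDeriv hc hw) _)
  rw [← h1, ← h2, h4, h3]
  rfl

/-- In natural coordinates the inclusion of a fibre is affine in `v`. -/
theorem mdifferentiableAt_fibreIncl {q : Q} (hq : q ∈ c.source) (s : Fin k → ℝ)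
    (v : VelModel n k) :
    MDifferentiableAt 𝓘(ℝ, VelModel n k) (lagI n k) (fibreIncl q s) v := by
  have h1 := (isLocalCoords_lag hc (x := fibreIncl q s v) hq).mdifferentiableAt_symm
  have h2 : (fibreIncl q s : VelModel n k → LagSpace n k Q) = fromCoords c ∘ fun v : VelModel n k =>
      ((c q, chartDeriv c q ∘L v, s) : EuclideanSpace ℝ (Fin n) × VelModel n k × (Fin k → ℝ)) := by
    funext v
    exact (fromCoords_toCoords hc (x := fibreIncl q s v) hq).symm
  rw [h2]
  refine MDifferentiableAt.comp v h1 (DifferentiableAt.mdifferentiableAt ?_)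
  fun_prop

theorem coordDeriv_mfderiv_fibreIncl {x : LagSpace n k Q} (hx : tauQ x ∈ c.source)
    (V : VelModel n k) :
    coordDeriv (lagI n k) (toCoords c) x
      (mfderiv 𝓘(ℝ, VelModel n k) (lagI n k) (fibreIncl (tauQ x) x.2) (velocities x) V) =
      (0, chartDeriv c (tauQ x) ∘L V, 0) := by
  have h1 := mfderiv_comp (velocities x)
    ((isLocalCoords_lag hc hx).mdifferentiableAt : MDifferentiableAt _ _ _
      (fibreIncl (tauQ x) x.2 (velocities x))) (mdifferentiableAt_fibreIncl hc hx x.2 (velocities x))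
  have h2 : HasFDerivAt ((toCoords c : LagSpace n k Q → _) ∘ fibreIncl (tauQ x) x.2)
      ((0 : VelModel n k →L[ℝ] EuclideanSpace ℝ (Fin n)).prod
        ((ContinuousLinearMap.compL ℝ (Fin k → ℝ) (EuclideanSpace ℝ (Fin n))
          (EuclideanSpace ℝ (Fin n)) (chartDeriv c (tauQ x))).prod
          (0 : VelModel n k →L[ℝ] (Fin k → ℝ)))) (velocities x) := by
    have h3 := (hasFDerivAt_const (𝕜 := ℝ) (c (tauQ x)) (velocities x)).prodMk
      ((ContinuousLinearMap.compL ℝ (Fin k → ℝ) (EuclideanSpace ℝ (Fin n))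
        (EuclideanSpace ℝ (Fin n)) (chartDeriv c (tauQ x))).hasFDerivAt.prodMk
          (hasFDerivAt_const (𝕜 := ℝ) x.2 (velocities x)))
    exact h3
  rw [mfderiv_eq_fderiv, h2.fderiv] at h1
  exact (DFunLike.congr_fun h1 V).symm

theorem coordDeriv_verticalLift {x : LagSpace n k Q} (hx : tauQ x ∈ c.source) (α : Fin k)
    (z : TangentSpace (𝓡 n) (tauQ x)) :
    coordDeriv (lagI n k) (toCoords c) x (verticalLift x α z) =
      velSlot α (chartDeriv c (tauQ x) z) := by
  have h := coordDeriv_mfderiv_fibreIncl hc hx (inSlot α z)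
  refine Eq.trans h (Prod.ext rfl (Prod.ext ?_ rfl))
  ext1 w
  exact map_smul (chartDeriv c (tauQ x)) (w α) z

theorem chartDeriv_mfderiv_tauQ {x : LagSpace n k Q} (hx : tauQ x ∈ c.source)
    (u : TangentSpace (lagI n k) x) :
    chartDeriv c (tauQ x) (mfderiv (lagI n k) (𝓡 n) tauQ x u) =
      (coordDeriv (lagI n k) (toCoords c) x u).1 := by
  rw [chartDeriv_mfderiv hc (contMDiff_tauQ.mdifferentiableAt (by simp)) hx]
  let A : LagCoords n k →L[ℝ] EuclideanSpace ℝ (Fin n) := ContinuousLinearMap.fst ℝ _ _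
  have h3 := mfderiv_comp x (A.differentiableAt (x := toCoords c x)).mdifferentiableAt
    (isLocalCoords_lag hc hx).mdifferentiableAt
  rw [mfderiv_eq_fderiv, A.fderiv] at h3
  exact DFunLike.congr_fun h3 u

theorem coordDeriv_tangentStructure {x : LagSpace n k Q} (hx : tauQ x ∈ c.source) (α : Fin k)
    (u : TangentSpace (lagI n k) x) :
    coordDeriv (lagI n k) (toCoords c) x (tangentStructure α x u) =
      velSlot α (coordDeriv (lagI n k) (toCoords c) x u).1 := by
  rw [← chartDeriv_mfderiv_tauQ hc hx]
  exact coordDeriv_verticalLift hc hx α _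

theorem coordDeriv_liouville {x : LagSpace n k Q} (hx : tauQ x ∈ c.source) :
    coordDeriv (lagI n k) (toCoords c) x (liouville x) = (0, (toCoords c x).2.1, 0) := by
  rw [← sum_velSlot]
  refine (map_sum (coordDeriv (lagI n k) (toCoords c) x) _ _).trans ?_
  exact Finset.sum_congr rfl fun α _ => coordDeriv_verticalLift hc hx α _

/-! ### Contact forms, energy and Legendre map of a Lagrangian in natural coordinates -/

section Lagrangian

variable {L : LagSpace n k Q → ℝ} (hL : ContMDiff (lagI n k) 𝓘(ℝ, ℝ) ∞ L)
include hL

theorem contDiffAt_lagrangian {x : LagSpace n k Q} (hx : tauQ x ∈ c.source) :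
    ContDiffAt ℝ ∞ (fun y => L (fromCoords c y)) (toCoords c x) :=
  contMDiffAt_iff_contDiffAt.1
    (hL.contMDiffAt.comp _ (isLocalCoords_lag hc hx).contMDiffAt_symm)

theorem differential_lagrangian {x : LagSpace n k Q} (hx : tauQ x ∈ c.source)
    (u : TangentSpace (lagI n k) x) :
    differential (lagI n k) L x u = fderiv ℝ (fun y => L (fromCoords c y)) (toCoords c x)
      (coordDeriv (lagI n k) (toCoords c) x u) := by
  refine differential_eq_of_eventuallyEq (isLocalCoords_lag hc hx).mdifferentiableAt
    ((contDiffAt_lagrangian hc hL hx).differentiableAt (by simp)) ?_ u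
  filter_upwards [(isLocalCoords_lag hc hx).right_inv] with z hz
  exact (congrArg L hz).symm

theorem lagContactForm_apply {x : LagSpace n k Q} (hx : tauQ x ∈ c.source) (α : Fin k)
    (u : TangentSpace (lagI n k) x) :
    lagContactForm L α x u = (coordDeriv (lagI n k) (toCoords c) x u).2.2 α -
      coordMomentum (fun y => L (fromCoords c y)) α (toCoords c x)
        (coordDeriv (lagI n k) (toCoords c) x u).1 := by
  have h1 : differential (lagI n k) (fun y : LagSpace n k Q => y.2 α) x u =
      (coordDeriv (lagI n k) (toCoords c) x u).2.2 α := by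
    let A : LagCoords n k →L[ℝ] ℝ :=
      ContinuousLinearMap.proj (R := ℝ) (φ := fun _ : Fin k => ℝ) α ∘L
        ContinuousLinearMap.snd ℝ _ _ ∘L ContinuousLinearMap.snd ℝ _ _
    have h := differential_eq_of_eventuallyEq (g := A) (h := fun y : LagSpace n k Q => y.2 α)
      (isLocalCoords_lag hc hx).mdifferentiableAt A.differentiableAt
      (Eventually.of_forall fun _ => rfl) u
    rw [A.fderiv] at h
    exact h
  have h2 := differential_lagrangian hc hL hx (tangentStructure α x u)
  rw [coordDeriv_tangentStructure hc hx] at h2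
  exact congrArg₂ (· - ·) h1 h2

theorem energy_eq {x : LagSpace n k Q} (hx : tauQ x ∈ c.source) :
    energy L x = ∑ α, coordMomentum (fun y => L (fromCoords c y)) α (toCoords c x)
      ((toCoords c x).2.1 (Pi.single α 1)) - L (fromCoords c (toCoords c x)) := by
  rw [sum_coordMomentum, energy, differential_lagrangian hc hL hx, coordDeriv_liouville hc hx,
    fromCoords_toCoords hc hx]

/-- The fibre derivative of `L` in the `α`-th slot is `dL` applied to the `α`-th vertical lift. -/
theorem momComp_legendre {x : LagSpace n k Q} (hx : tauQ x ∈ c.source) (α : Fin k)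
    (z : EuclideanSpace ℝ (Fin n)) :
    momComp (legendre L x) α z = coordMomentum (fun y => L (fromCoords c y)) α (toCoords c x)
        (chartDeriv c (tauQ x) z) := by
  have h1 := mfderiv_comp (velocities x) (hL.mdifferentiableAt (by simp) :
    MDifferentiableAt _ 𝓘(ℝ, ℝ) L (fibreIncl (tauQ x) x.2 (velocities x)))
    (mdifferentiableAt_fibreIncl hc hx x.2 (velocities x))
  rw [mfderiv_eq_fderiv] at h1
  have h2 := differential_lagrangian hc hL hx (verticalLift x α z)
  exact (DFunLike.congr_fun h1 (inSlot α z)).trans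
    (h2.trans (congrArg (fderiv ℝ _ _) (coordDeriv_verticalLift hc hx α z)))

end Lagrangian

end Expressions

/-! ### The field equations in coordinates -/

section CoordinateEquations

variable {n k : ℕ}

section

variable {F X : Type*} [NormedAddCommGroup F] [NormedSpace ℝ F] [NormedAddCommGroup X]
  [NormedSpace ℝ X]

/-- The form `a - m ∘ b`. -/
def subCompForm (a : F →L[ℝ] ℝ) (b : F →L[ℝ] X) (m : X →L[ℝ] ℝ) : F →L[ℝ] ℝ := a - m ∘L b

/-- The contact forms on both bundles have this shape, with `a = ds^α` and `b = dq` constant, so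
only the momentum `m` contributes to the derivative. -/
theorem hasFDerivAt_subCompForm (a : F →L[ℝ] ℝ) (b : F →L[ℝ] X) {m : F → X →L[ℝ] ℝ}
    {m' : F →L[ℝ] X →L[ℝ] ℝ} {y : F} (hm : HasFDerivAt m m' y) :
    HasFDerivAt (fun y => subCompForm a b (m y))
      (-((ContinuousLinearMap.compL ℝ F X ℝ).flip b ∘L m')) y :=
  (((ContinuousLinearMap.compL ℝ F X ℝ).flip b).hasFDerivAt.comp y hm).const_sub a

theorem differentiableAt_subCompForm (a : F →L[ℝ] ℝ) (b : F →L[ℝ] X) {m : F → X →L[ℝ] ℝ}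
    {y : F} (hm : DifferentiableAt ℝ m y) :
    DifferentiableAt ℝ (fun y => subCompForm a b (m y)) y :=
  (hasFDerivAt_subCompForm a b hm.hasFDerivAt).differentiableAt

theorem fderiv_subCompForm (a : F →L[ℝ] ℝ) (b : F →L[ℝ] X) {m : F → X →L[ℝ] ℝ}
    {y : F} (hm : DifferentiableAt ℝ m y) (u v : F) :
    fderiv ℝ (fun y => subCompForm a b (m y)) y u v = -fderiv ℝ m y u (b v) := by
  rw [(hasFDerivAt_subCompForm a b hm.hasFDerivAt).fderiv]
  rfl

end

theorem differentiableAt_coordMomentum {l : LagCoords n k → ℝ} {y : LagCoords n k}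
    (hl : ContDiffAt ℝ ∞ l y) (α : Fin k) : DifferentiableAt ℝ (coordMomentum l α) y := by
  have h : DifferentiableAt ℝ (fderiv ℝ l) y :=
    (hl.fderiv_right (m := ∞) (by simp)).differentiableAt (by simp)
  exact h.clm_comp (differentiableAt_const _)

/-- The `α`-th momentum, as a linear function on the space of natural coordinates. -/
def momCoord (α : Fin k) : PontCoords n k →L[ℝ] EuclideanSpace ℝ (Fin n) →L[ℝ] ℝ :=
  ContinuousLinearMap.compL ℝ (EuclideanSpace ℝ (Fin n)) (Fin k → ℝ) ℝ
      (ContinuousLinearMap.proj (R := ℝ) (φ := fun _ : Fin k => ℝ) α) ∘L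
    ContinuousLinearMap.fst ℝ _ _ ∘L ContinuousLinearMap.snd ℝ _ _ ∘L
      ContinuousLinearMap.snd ℝ _ _

/-- The contact forms of the extended Pontryagin bundle in natural coordinates. -/
def coordContactForm (α : Fin k) (y : PontCoords n k) : PontCoords n k →L[ℝ] ℝ :=
  subCompForm (ContinuousLinearMap.proj (R := ℝ) (φ := fun _ : Fin k => ℝ) α ∘L
      ContinuousLinearMap.snd ℝ _ _ ∘L ContinuousLinearMap.snd ℝ _ _ ∘L
        ContinuousLinearMap.snd ℝ _ _)
    (ContinuousLinearMap.fst ℝ _ _) (momCoord α y)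

theorem differentiable_coordContactForm (α : Fin k) :
    Differentiable ℝ (coordContactForm α : PontCoords n k → _) := fun _ =>
  differentiableAt_subCompForm _ _ (momCoord α).differentiableAt

theorem fderiv_coordContactForm (α : Fin k) (y u v : PontCoords n k) :
    fderiv ℝ (coordContactForm α) y u v = -u.2.2.1 v.1 α := by
  refine (fderiv_subCompForm _ _ (momCoord α).differentiableAt u v).trans ?_
  rw [(momCoord α).fderiv]
  rfl

/-- The Lagrangian contact forms in natural coordinates. -/
def coordLagContactForm (l : LagCoords n k → ℝ) (α : Fin k) (y : LagCoords n k) :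
    LagCoords n k →L[ℝ] ℝ :=
  subCompForm (ContinuousLinearMap.proj (R := ℝ) (φ := fun _ : Fin k => ℝ) α ∘L
      ContinuousLinearMap.snd ℝ _ _ ∘L ContinuousLinearMap.snd ℝ _ _)
    (ContinuousLinearMap.fst ℝ _ _) (coordMomentum l α y)

theorem differentiableAt_coordLagContactForm {l : LagCoords n k → ℝ} {y : LagCoords n k}
    (hl : ContDiffAt ℝ ∞ l y) (α : Fin k) : DifferentiableAt ℝ (coordLagContactForm l α) y :=
  differentiableAt_subCompForm _ _ (differentiableAt_coordMomentum hl α)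

theorem fderiv_coordLagContactForm {l : LagCoords n k → ℝ} {y : LagCoords n k}
    (hl : ContDiffAt ℝ ∞ l y) (α : Fin k) (u v : LagCoords n k) :
    fderiv ℝ (coordLagContactForm l α) y u v = -fderiv ℝ (coordMomentum l α) y u v.1 :=
  fderiv_subCompForm _ _ (differentiableAt_coordMomentum hl α) u v

/-- The energy in natural coordinates. -/
def coordEnergy (l : LagCoords n k → ℝ) (y : LagCoords n k) : ℝ :=
  ∑ α, coordMomentum l α y (y.2.1 (Pi.single α 1)) - l y

theorem differentiableAt_and_fderiv_coordEnergy {l : LagCoords n k → ℝ} {y : LagCoords n k}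
    (hl : ContDiffAt ℝ ∞ l y) : DifferentiableAt ℝ (coordEnergy l) y ∧ ∀ u : LagCoords n k,
      fderiv ℝ (coordEnergy l) y u = ∑ α, (coordMomentum l α y (u.2.1 (Pi.single α 1)) +
        fderiv ℝ (coordMomentum l α) y u (y.2.1 (Pi.single α 1))) - fderiv ℝ l y u := by
  let B : Fin k → LagCoords n k →L[ℝ] EuclideanSpace ℝ (Fin n) := fun α =>
    ContinuousLinearMap.apply ℝ (EuclideanSpace ℝ (Fin n)) (Pi.single α 1 : Fin k → ℝ) ∘L
      ContinuousLinearMap.fst ℝ _ _ ∘L ContinuousLinearMap.snd ℝ _ _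
  have h2 : ∀ α, HasFDerivAt (fun y : LagCoords n k => coordMomentum l α y (B α y))
      ((coordMomentum l α y) ∘L B α + (fderiv ℝ (coordMomentum l α) y).flip (B α y)) y := fun α =>
    (differentiableAt_coordMomentum hl α).hasFDerivAt.clm_apply (B α).hasFDerivAt
  have h3 : HasFDerivAt (coordEnergy l) (∑ α, ((coordMomentum l α y) ∘L B α +
      (fderiv ℝ (coordMomentum l α) y).flip (B α y)) - fderiv ℝ l y) y :=
    (HasFDerivAt.fun_sum fun α _ => h2 α).sub (hl.differentiableAt (by simp)).hasFDerivAt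
  refine ⟨h3.differentiableAt, fun u => ?_⟩
  rw [h3.fderiv]
  simp only [sub_apply, sum_apply]
  rfl

/-- The variation of `v` in `(∂L/∂v) v` cancels the `v`-part of `dL`. -/
theorem fderiv_coordEnergy {l : LagCoords n k → ℝ} {y : LagCoords n k}
    (hl : ContDiffAt ℝ ∞ l y) (u : LagCoords n k) : fderiv ℝ (coordEnergy l) y u =
      ∑ α, fderiv ℝ (coordMomentum l α) y u (y.2.1 (Pi.single α 1)) -
        fderiv ℝ l y (u.1, 0, u.2.2) := by
  rw [(differentiableAt_and_fderiv_coordEnergy hl).2 u]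
  have h1 : fderiv ℝ l y u = fderiv ℝ l y (u.1, 0, u.2.2) + fderiv ℝ l y (0, u.2.1, 0) := by
    rw [← map_add]; simp
  have h2 := sum_coordMomentum l y u.2.1
  rw [h1, ← h2, Finset.sum_add_distrib]
  ring

/-- The Hamiltonian function in natural coordinates. -/
def coordHamiltonian (l : LagCoords n k → ℝ) (y : PontCoords n k) : ℝ :=
  ∑ α, y.2.2.1 (y.2.1 (Pi.single α 1)) α - l (y.1, y.2.1, y.2.2.2)

theorem differentiableAt_and_fderiv_coordHamiltonian {l : LagCoords n k → ℝ} {y : PontCoords n k}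
    (hl : DifferentiableAt ℝ l (y.1, y.2.1, y.2.2.2)) :
    DifferentiableAt ℝ (coordHamiltonian l) y ∧ ∀ u : PontCoords n k,
      fderiv ℝ (coordHamiltonian l) y u = ∑ α, (y.2.2.1 (u.2.1 (Pi.single α 1)) α +
        u.2.2.1 (y.2.1 (Pi.single α 1)) α) - fderiv ℝ l (y.1, y.2.1, y.2.2.2)
          (u.1, u.2.1, u.2.2.2) := by
  let P : PontCoords n k →L[ℝ] LagCoords n k := (ContinuousLinearMap.fst ℝ _ _).prod
    ((ContinuousLinearMap.fst ℝ _ _ ∘L ContinuousLinearMap.snd ℝ _ _).prod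
      (ContinuousLinearMap.snd ℝ _ _ ∘L ContinuousLinearMap.snd ℝ _ _ ∘L
        ContinuousLinearMap.snd ℝ _ _))
  have h1 : HasFDerivAt (fun y : PontCoords n k => l (P y)) (fderiv ℝ l (P y) ∘L P) y :=
    HasFDerivAt.comp y (DifferentiableAt.hasFDerivAt hl) P.hasFDerivAt
  let A : PontCoords n k →L[ℝ] MomModel n k := ContinuousLinearMap.fst ℝ _ _ ∘L
      ContinuousLinearMap.snd ℝ _ _ ∘L ContinuousLinearMap.snd ℝ _ _
  let B : Fin k → PontCoords n k →L[ℝ] EuclideanSpace ℝ (Fin n) := fun α =>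
    ContinuousLinearMap.apply ℝ (EuclideanSpace ℝ (Fin n)) (Pi.single α 1 : Fin k → ℝ) ∘L
      ContinuousLinearMap.fst ℝ _ _ ∘L ContinuousLinearMap.snd ℝ _ _
  have h2 : ∀ α, HasFDerivAt (fun y : PontCoords n k => y.2.2.1 (y.2.1 (Pi.single α 1)) α)
      (ContinuousLinearMap.proj (R := ℝ) (φ := fun _ : Fin k => ℝ) α ∘L
        ((A y) ∘L B α + A.flip (B α y))) y := fun α =>
    HasFDerivAt.comp y (ContinuousLinearMap.proj (R := ℝ) (φ := fun _ : Fin k => ℝ) α).hasFDerivAt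
      (A.hasFDerivAt.clm_apply (B α).hasFDerivAt)
  have h3 : HasFDerivAt (coordHamiltonian l) (∑ α, (ContinuousLinearMap.proj (R := ℝ)
      (φ := fun _ : Fin k => ℝ) α ∘L ((A y) ∘L B α + A.flip (B α y))) - fderiv ℝ l (P y) ∘L P) y :=
    (HasFDerivAt.fun_sum fun α _ => h2 α).sub h1
  refine ⟨h3.differentiableAt, fun u => ?_⟩
  rw [h3.fderiv]
  simp only [sub_apply, sum_apply]
  rfl

end CoordinateEquations

/-! ### Solving the field equations at a point -/

section CoordinateSolutions

variable {n k : ℕ}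

theorem fderiv_lag_single_sum (l : LagCoords n k → ℝ) (y : LagCoords n k) (s : Fin k → ℝ) :
    fderiv ℝ l y (0, 0, s) = ∑ α, s α * fderiv ℝ l y (0, 0, Pi.single α 1) := by
  let A : (Fin k → ℝ) →L[ℝ] ℝ := fderiv ℝ l y ∘L ContinuousLinearMap.inr ℝ _ _ ∘L
    ContinuousLinearMap.inr ℝ _ _
  have h : A s = ∑ α, s α * A (Pi.single α 1) := by
    conv_lhs => rw [← Finset.univ_sum_single s, map_sum]
    refine Finset.sum_congr rfl fun α _ => ?_
    rw [← smul_eq_mul, ← map_smul, ← Pi.single_smul, smul_eq_mul, mul_one]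
  exact h

theorem fderiv_lag_split (l : LagCoords n k → ℝ) (y : LagCoords n k)
    (q : EuclideanSpace ℝ (Fin n)) (v : VelModel n k) (s : Fin k → ℝ) :
    fderiv ℝ l y (q, v, s) = fderiv ℝ l y (q, 0, 0) + fderiv ℝ l y (0, v, 0) +
      ∑ α, s α * fderiv ℝ l y (0, 0, Pi.single α 1) := by
  rw [← fderiv_lag_single_sum, ← map_add, ← map_add]
  simp

/-- Covectors concentrated in the `α`-th place. -/
def momSlot (α : Fin k) (z : EuclideanSpace ℝ (Fin n)) : MomModel n k :=
  (innerSL ℝ z).smulRight (Pi.single α 1)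

/-- Testing on the covector `⟨z, ·⟩` placed in slot `α` gives `|z|² = 0`. Using only such covectors
isolates one index in a sum over `α`. -/
theorem eq_zero_of_forall_momSlot {α : Fin k} {z : EuclideanSpace ℝ (Fin n)}
    (h : ∀ P : MomModel n k, (∀ β ≠ α, ∀ u, P u β = 0) → P z α = 0) : z = 0 := by
  have h1 := h (momSlot α z) fun β hβ u => by simp [momSlot, hβ]
  simpa [momSlot] using h1

theorem skinnerRusk_coords {l : LagCoords n k → ℝ} {y : PontCoords n k}
    (hl : DifferentiableAt ℝ l (y.1, y.2.1, y.2.2.2))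
    (hleg : ∀ α z, y.2.2.1 z α = coordMomentum l α (y.1, y.2.1, y.2.2.2) z)
    {Z R : Fin k → PontCoords n k}
    (hR : ∀ α β, (∀ W : PontCoords n k, W.2.2.1 (R α).1 β - (R α).2.2.1 W.1 β = 0) ∧
      (R α).2.2.2 β - y.2.2.1 (R α).1 β = if α = β then 1 else 0)
    (hZ : ∀ W : PontCoords n k, ∑ α, (W.2.2.1 (Z α).1 α - (Z α).2.2.1 W.1 α) =
      fderiv ℝ (coordHamiltonian l) y W -
        ∑ α, fderiv ℝ (coordHamiltonian l) y (R α) * (W.2.2.2 α - y.2.2.1 W.1 α))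
    (hZ' : ∑ α, ((Z α).2.2.2 α - y.2.2.1 (Z α).1 α) = -coordHamiltonian l y) :
    (∀ α, (Z α).1 = y.2.1 (Pi.single α 1)) ∧
    (∀ z, ∑ α, (Z α).2.2.1 z α = fderiv ℝ l (y.1, y.2.1, y.2.2.2) (z, 0, 0) +
      ∑ α, fderiv ℝ l (y.1, y.2.1, y.2.2.2) (0, 0, Pi.single α 1) *
        coordMomentum l α (y.1, y.2.1, y.2.2.2) z) ∧
    ∑ α, (Z α).2.2.2 α = l (y.1, y.2.1, y.2.2.2) := by
  set yL : LagCoords n k := (y.1, y.2.1, y.2.2.2) with hyL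
  -- The Legendre relation cancels the `v`-part of `dH`.
  have hD : ∀ W : PontCoords n k, fderiv ℝ (coordHamiltonian l) y W =
      ∑ α, W.2.2.1 (y.2.1 (Pi.single α 1)) α - fderiv ℝ l yL (W.1, 0, 0) -
        ∑ α, W.2.2.2 α * fderiv ℝ l yL (0, 0, Pi.single α 1) := by
    intro W
    rw [(differentiableAt_and_fderiv_coordHamiltonian hl).2 W, ← hyL, fderiv_lag_split, Finset.sum_add_distrib,
      ← sum_coordMomentum]
    simp only [hleg]
    ring
  have hRq : ∀ α, (R α).1 = 0 := fun α => eq_zero_of_forall_momSlot (α := α) fun P _ => by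
    simpa using (hR α α).1 (0, 0, P, 0)
  have hRp : ∀ α β z, (R α).2.2.1 z β = 0 := fun α β z => by
    simpa using (hR α β).1 (z, 0, 0, 0)
  have hRs : ∀ α β, (R α).2.2.2 β = if α = β then 1 else 0 := fun α β => by
    simpa [hRq] using (hR α β).2
  -- The unconstrained `v`-component of the Reeb vector does not appear in `hD`.
  have hRH : ∀ α, fderiv ℝ (coordHamiltonian l) y (R α) =
      -fderiv ℝ l yL (0, 0, Pi.single α 1) := fun α => by
    have h0 : ((0, 0, 0) : LagCoords n k) = 0 := rfl
    rw [hD, hRq]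
    simp [hRp, hRs, h0]
  simp only [hRH] at hZ
  have h1 : ∀ α, (Z α).1 = y.2.1 (Pi.single α 1) := by
    intro α
    rw [← sub_eq_zero]
    refine eq_zero_of_forall_momSlot (α := α) fun P hP => ?_
    have h0 : ((0, 0, 0) : LagCoords n k) = 0 := rfl
    -- The `dp`-part of the equation, which gives holonomy.
    have h := hZ (0, 0, P, 0)
    rw [hD] at h
    simp only [h0, map_zero, Pi.zero_apply, sub_zero, zero_mul, mul_zero,
      Finset.sum_const_zero] at h
    rw [Finset.sum_eq_single_of_mem α (Finset.mem_univ _) fun β _ hβ => ?_,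
      Finset.sum_eq_single_of_mem α (Finset.mem_univ _) fun β _ hβ => ?_] at h
    · rw [map_sub, Pi.sub_apply, h, sub_self]
    · exact hP β hβ _
    · exact hP β hβ _
  refine ⟨h1, fun z => ?_, ?_⟩
  -- The `dq`-part of the equation; the Reeb term contributes `(∂L/∂s^α) p^α`.
  · have h := hZ (z, 0, 0, 0)
    rw [hD] at h
    simp only [zero_apply, Pi.zero_apply, zero_sub, Finset.sum_const_zero, zero_mul, sub_zero,
      Finset.sum_neg_distrib, neg_mul, mul_neg, neg_neg, hleg] at h
    linarith
  -- By holonomy the same sum `∑ p^α(v_α)` occurs on both sides and leaves `L`.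
  · simp only [h1, Finset.sum_sub_distrib] at hZ'
    rw [coordHamiltonian, ← hyL] at hZ'
    linarith

/-- Only the value of `R_α E_L` needs an argument. For singular `L` the `q`-component of `R_α` may
be nonzero, and its contributions cancel only because `Z` satisfies the Euler–Lagrange equations. -/
theorem eulerLagrange_coords {l : LagCoords n k → ℝ} {y : LagCoords n k}
    (hl : ContDiffAt ℝ ∞ l y) {Z R : Fin k → LagCoords n k}
    (hR : ∀ α β, (∀ W : LagCoords n k, fderiv ℝ (coordMomentum l β) y W (R α).1 -
        fderiv ℝ (coordMomentum l β) y (R α) W.1 = 0) ∧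
      (R α).2.2 β - coordMomentum l β y (R α).1 = if α = β then 1 else 0)
    (hq : ∀ α, (Z α).1 = y.2.1 (Pi.single α 1))
    (hp : ∀ z, ∑ α, fderiv ℝ (coordMomentum l α) y (Z α) z = fderiv ℝ l y (z, 0, 0) +
      ∑ α, fderiv ℝ l y (0, 0, Pi.single α 1) * coordMomentum l α y z)
    (hs : ∑ α, (Z α).2.2 α = l y) :
    (∀ W : LagCoords n k, ∑ α, (fderiv ℝ (coordMomentum l α) y W (Z α).1 -
        fderiv ℝ (coordMomentum l α) y (Z α) W.1) =
      fderiv ℝ (coordEnergy l) y W -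
        ∑ α, fderiv ℝ (coordEnergy l) y (R α) * (W.2.2 α - coordMomentum l α y W.1)) ∧
    ∑ α, ((Z α).2.2 α - coordMomentum l α y (Z α).1) = -coordEnergy l y := by
  have hE : ∀ W : LagCoords n k, fderiv ℝ (coordEnergy l) y W =
      ∑ α, fderiv ℝ (coordMomentum l α) y W (y.2.1 (Pi.single α 1)) - fderiv ℝ l y (W.1, 0, 0) -
        ∑ α, W.2.2 α * fderiv ℝ l y (0, 0, Pi.single α 1) := by
    intro W
    have h0 : ((0, 0, 0) : LagCoords n k) = 0 := rfl
    rw [fderiv_coordEnergy hl, fderiv_lag_split, h0, map_zero]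
    ring
  have hRE : ∀ α, fderiv ℝ (coordEnergy l) y (R α) = -fderiv ℝ l y (0, 0, Pi.single α 1) := by
    intro α
    -- The Reeb condition for `η_L^β`, tested on `Z_β`, exchanges the two arguments, so that `hp`
    -- becomes applicable at the `q`-component of `R α`.
    have h1 : ∑ β, fderiv ℝ (coordMomentum l β) y (R α) (y.2.1 (Pi.single β 1)) =
        ∑ β, fderiv ℝ (coordMomentum l β) y (Z β) (R α).1 :=
      Finset.sum_congr rfl fun β _ => by
        rw [← hq β]; exact (sub_eq_zero.1 ((hR α β).1 (Z β))).symm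
    have h2 : ∀ β, (R α).2.2 β = (if α = β then 1 else 0) + coordMomentum l β y (R α).1 :=
      fun β => by rw [← (hR α β).2]; ring
    rw [hE, h1, hp]
    simp only [h2, add_mul, Finset.sum_add_distrib, ite_mul, one_mul, zero_mul,
      Finset.sum_ite_eq, Finset.mem_univ, if_true, mul_comm (fderiv ℝ l y _)]
    ring
  refine ⟨fun W => ?_, ?_⟩
  · simp only [hRE, hq]
    rw [hE, Finset.sum_sub_distrib, hp]
    simp only [neg_mul, mul_sub, Finset.sum_sub_distrib, Finset.sum_neg_distrib,
      mul_comm (W.2.2 _)]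
    ring
  · rw [coordEnergy, Finset.sum_sub_distrib, hs]
    simp only [hq]
    ring

end CoordinateSolutions

/-! ### From the Skinner–Rusk equations to the Euler–Lagrange equations -/

section Main

variable {n k : ℕ} {Q : Type*} [TopologicalSpace Q] [ChartedSpace (EuclideanSpace ℝ (Fin n)) Q]
  [IsManifold (𝓡 n) ∞ Q]
  {c : OpenPartialHomeomorph Q (EuclideanSpace ℝ (Fin n))}
  (hc : c ∈ IsManifold.maximalAtlas (𝓡 n) ∞ Q)

theorem eventually_pontBase_mem_source {w : Pontryagin n k Q} (hw : pontBase w ∈ c.source) :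
    ∀ᶠ z in 𝓝 w, pontBase z ∈ c.source :=
  contMDiff_pontBase.continuous.continuousAt.preimage_mem_nhds (c.open_source.mem_nhds hw)

theorem eventually_tauQ_mem_source {x : LagSpace n k Q} (hx : tauQ x ∈ c.source) :
    ∀ᶠ z in 𝓝 x, tauQ z ∈ c.source :=
  contMDiff_tauQ.continuous.continuousAt.preimage_mem_nhds (c.open_source.mem_nhds hx)

include hc

theorem extDerivForm_contactForm {w : Pontryagin n k Q} (hw : pontBase w ∈ c.source) (α : Fin k)
    (u v : TangentSpace (pontI n k) w) :
    extDerivForm (pontI n k) (contactForm α) w u v =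
      (coordDeriv (pontI n k) (pontToCoords c) w v).2.2.1
          (coordDeriv (pontI n k) (pontToCoords c) w u).1 α -
        (coordDeriv (pontI n k) (pontToCoords c) w u).2.2.1
          (coordDeriv (pontI n k) (pontToCoords c) w v).1 α := by
  have hpull := pullForm_eventuallyEq (η := contactForm α) (ζ := coordContactForm α)
    (isLocalCoords_pont hc hw) <| by
      filter_upwards [eventually_pontBase_mem_source hw] with z hz
      exact ⟨isLocalCoords_pont hc hz, fun u => contactForm_apply hc hz α u⟩
  have h := (isLocalCoords_pont hc hw).extDerivForm_eq hpull
    (differentiable_coordContactForm α _) u v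
  rw [fderiv_coordContactForm, fderiv_coordContactForm] at h
  rw [h]
  ring

omit [IsManifold (𝓡 n) ∞ Q] in
theorem coupling_eq {w : Pontryagin n k Q} (hw : pontBase w ∈ c.source) :
    coupling w = ∑ α, (pontToCoords c w).2.2.1 ((pontToCoords c w).2.1 (Pi.single α 1)) α := by
  refine Finset.sum_congr rfl fun α _ => ?_
  exact congrArg (fun z => pontMom w z α) (DFunLike.congr_fun
    (chartSymmDeriv_comp_chartDeriv hc hw) (pontVel w (Pi.single α 1))).symm

omit [IsManifold (𝓡 n) ∞ Q] in
theorem hamiltonian_eq (L : LagSpace n k Q → ℝ) {w : Pontryagin n k Q}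
    (hw : pontBase w ∈ c.source) :
    hamiltonian L w = coordHamiltonian (fun y => L (fromCoords c y)) (pontToCoords c w) := by
  rw [hamiltonian, coupling_eq hc hw, coordHamiltonian,
    ← fromCoords_toCoords hc (x := rho1 w) hw]
  rfl

/-! ### From intrinsic equations at a point to coordinates and back -/

section Lagrangian

variable {L : LagSpace n k Q → ℝ} (hL : ContMDiff (lagI n k) 𝓘(ℝ, ℝ) ∞ L)
include hL

theorem momentum_eq_of_mem_firstConstraint {w : Pontryagin n k Q} (hw : pontBase w ∈ c.source)
    (hw₁ : w ∈ firstConstraint L) (α : Fin k) (z : EuclideanSpace ℝ (Fin n)) :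
    (pontToCoords c w).2.2.1 z α =
      coordMomentum (fun y => L (fromCoords c y)) α (toCoords c (rho1 w)) z := by
  -- The domain of `momComp` depends on the base point, so the equality of points is used with a
  -- vector of the model space.
  have hcongr : ∀ x x' : HamSpace n k Q, x = x' → ∀ u : EuclideanSpace ℝ (Fin n),
      momComp x α u = momComp x' α u := by
    rintro x _ rfl u; rfl
  have h := (hcongr _ _ hw₁ (chartSymmDeriv c (c (pontBase w)) z)).trans
    (momComp_legendre hc hL (x := rho1 w) hw α _)
  have h2 : chartDeriv c (pontBase w) (chartSymmDeriv c (c (pontBase w)) z) = z := by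
    have h3 := chartDeriv_comp_chartSymmDeriv hc (c.map_source hw)
    rw [c.left_inv hw] at h3
    exact DFunLike.congr_fun h3 z
  exact h.trans (congrArg (coordMomentum _ α _) h2)

theorem skinnerRusk_equations {w : Pontryagin n k Q} (hw : pontBase w ∈ c.source)
    (hw₁ : w ∈ firstConstraint L) {R Z : Fin k → TangentSpace (pontI n k) w}
    (hR : IsReebAt (pontI n k) contactForm w R)
    (hZ : FieldEquationsAt (pontI n k) contactForm (hamiltonian L) w R Z) :
    (∀ α, (coordDeriv (pontI n k) (pontToCoords c) w (Z α)).1 =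
      (toCoords c (rho1 w)).2.1 (Pi.single α 1)) ∧
    (∀ z, ∑ α, (coordDeriv (pontI n k) (pontToCoords c) w (Z α)).2.2.1 z α =
      fderiv ℝ (fun y => L (fromCoords c y)) (toCoords c (rho1 w)) (z, 0, 0) +
      ∑ α, fderiv ℝ (fun y => L (fromCoords c y)) (toCoords c (rho1 w)) (0, 0, Pi.single α 1) *
        coordMomentum (fun y => L (fromCoords c y)) α (toCoords c (rho1 w)) z) ∧
    ∑ α, (coordDeriv (pontI n k) (pontToCoords c) w (Z α)).2.2.2 α = L (rho1 w) := by
  have hΨ := isLocalCoords_pont hc hw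
  have hl : DifferentiableAt ℝ (fun y => L (fromCoords c y)) (toCoords c (rho1 w)) :=
    (contDiffAt_lagrangian hc hL (x := rho1 w) hw).differentiableAt (by simp)
  have hH : ∀ u, differential (pontI n k) (hamiltonian L) w u =
      fderiv ℝ (coordHamiltonian fun y => L (fromCoords c y)) (pontToCoords c w)
        (coordDeriv (pontI n k) (pontToCoords c) w u) := by
    refine differential_eq_of_eventuallyEq hΨ.mdifferentiableAt
      (differentiableAt_and_fderiv_coordHamiltonian hl).1 ?_
    filter_upwards [eventually_pontBase_mem_source hw] with z hz
    exact hamiltonian_eq hc L hz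
  have hLw : L (rho1 w) = L (fromCoords c (toCoords c (rho1 w))) := by
    rw [fromCoords_toCoords hc (x := rho1 w) hw]
  rw [hLw]
  refine skinnerRusk_coords (l := fun y => L (fromCoords c y)) (y := pontToCoords c w)
    (R := fun α => coordDeriv (pontI n k) (pontToCoords c) w (R α)) hl
    (momentum_eq_of_mem_firstConstraint hc hL hw hw₁) (fun α β => ⟨fun W => ?_, ?_⟩)
    (fun W => ?_) ?_
  -- Every coordinate vector comes from a tangent vector, so the intrinsic condition can be tested
  -- on it.
  · obtain ⟨u, rfl⟩ := hΨ.exists_coordDeriv_eq W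
    rw [← extDerivForm_contactForm hc hw]
    exact (hR α β).1 u
  · rw [← (hR α β).2, contactForm_apply hc hw]
  · obtain ⟨u, rfl⟩ := hΨ.exists_coordDeriv_eq W
    have h := hZ.1 u
    simp only [extDerivForm_contactForm hc hw, contactForm_apply hc hw, hH] at h
    exact h
  · have h := hZ.2
    simp only [contactForm_apply hc hw, hamiltonian_eq hc L hw] at h
    exact h

theorem extDerivForm_lagContactForm {x : LagSpace n k Q} (hx : tauQ x ∈ c.source) (α : Fin k)
    (u v : TangentSpace (lagI n k) x) :
    extDerivForm (lagI n k) (lagContactForm L α) x u v =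
      fderiv ℝ (coordMomentum (fun y => L (fromCoords c y)) α) (toCoords c x)
          (coordDeriv (lagI n k) (toCoords c) x v) (coordDeriv (lagI n k) (toCoords c) x u).1 -
        fderiv ℝ (coordMomentum (fun y => L (fromCoords c y)) α) (toCoords c x)
          (coordDeriv (lagI n k) (toCoords c) x u) (coordDeriv (lagI n k) (toCoords c) x v).1 := by
  have hpull := pullForm_eventuallyEq (η := lagContactForm L α)
    (ζ := coordLagContactForm (fun y => L (fromCoords c y)) α) (isLocalCoords_lag hc hx) <| by
      filter_upwards [eventually_tauQ_mem_source hx] with z hz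
      exact ⟨isLocalCoords_lag hc hz, fun u => lagContactForm_apply hc hL hz α u⟩
  have hl := contDiffAt_lagrangian hc hL hx
  have h := (isLocalCoords_lag hc hx).extDerivForm_eq hpull
    (differentiableAt_coordLagContactForm hl α) u v
  rw [fderiv_coordLagContactForm hl, fderiv_coordLagContactForm hl] at h
  rw [h]
  ring

theorem fieldEquationsAt_lagContactForm {x : LagSpace n k Q} (hx : tauQ x ∈ c.source)
    {R Z : Fin k → TangentSpace (lagI n k) x}
    (hR : IsReebAt (lagI n k) (lagContactForm L) x R)
    (hq : ∀ α, (coordDeriv (lagI n k) (toCoords c) x (Z α)).1 =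
      (toCoords c x).2.1 (Pi.single α 1))
    (hp : ∀ z, ∑ α, fderiv ℝ (coordMomentum (fun y => L (fromCoords c y)) α) (toCoords c x)
        (coordDeriv (lagI n k) (toCoords c) x (Z α)) z =
      fderiv ℝ (fun y => L (fromCoords c y)) (toCoords c x) (z, 0, 0) +
      ∑ α, fderiv ℝ (fun y => L (fromCoords c y)) (toCoords c x) (0, 0, Pi.single α 1) *
        coordMomentum (fun y => L (fromCoords c y)) α (toCoords c x) z)
    (hs : ∑ α, (coordDeriv (lagI n k) (toCoords c) x (Z α)).2.2 α = L x) :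
    FieldEquationsAt (lagI n k) (lagContactForm L) (energy L) x R Z := by
  have hΨ := isLocalCoords_lag hc hx
  have hl := contDiffAt_lagrangian hc hL hx
  have hE : ∀ u, differential (lagI n k) (energy L) x u =
      fderiv ℝ (coordEnergy fun y => L (fromCoords c y)) (toCoords c x)
        (coordDeriv (lagI n k) (toCoords c) x u) := by
    refine differential_eq_of_eventuallyEq hΨ.mdifferentiableAt (differentiableAt_and_fderiv_coordEnergy hl).1 ?_
    filter_upwards [eventually_tauQ_mem_source hx] with z hz
    exact energy_eq hc hL hz
  have hLx : L x = L (fromCoords c (toCoords c x)) := by rw [fromCoords_toCoords hc hx]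
  rw [hLx] at hs
  have key := eulerLagrange_coords (l := fun y => L (fromCoords c y)) (y := toCoords c x)
    (Z := fun α => coordDeriv (lagI n k) (toCoords c) x (Z α))
    (R := fun α => coordDeriv (lagI n k) (toCoords c) x (R α)) hl
    (fun α β => ⟨fun W => by
      obtain ⟨u, rfl⟩ := hΨ.exists_coordDeriv_eq W
      rw [← extDerivForm_lagContactForm hc hL hx]
      exact (hR α β).1 u, by
      rw [← (hR α β).2, lagContactForm_apply hc hL hx]⟩) hq hp hs
  refine ⟨fun u => ?_, ?_⟩
  · simp only [extDerivForm_lagContactForm hc hL hx, lagContactForm_apply hc hL hx, hE]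
    exact key.1 _
  · simp only [lagContactForm_apply hc hL hx]
    rw [energy_eq hc hL hx]
    exact key.2

end Lagrangian

end Main

/-! ### Integral sections and their projections -/

section Sections

variable {n k : ℕ} {Q : Type*} [TopologicalSpace Q] [ChartedSpace (EuclideanSpace ℝ (Fin n)) Q]
  [IsManifold (𝓡 n) ∞ Q]
  {c : OpenPartialHomeomorph Q (EuclideanSpace ℝ (Fin n))}
  (hc : c ∈ IsManifold.maximalAtlas (𝓡 n) ∞ Q)

/-- The natural coordinates of `ρ_1 (w)`, in terms of those of `w`. -/
def lagCoordsOfPont : PontCoords n k →L[ℝ] LagCoords n k := (ContinuousLinearMap.fst ℝ _ _).prod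
  ((ContinuousLinearMap.fst ℝ _ _ ∘L ContinuousLinearMap.snd ℝ _ _).prod
    (ContinuousLinearMap.snd ℝ _ _ ∘L ContinuousLinearMap.snd ℝ _ _ ∘L
      ContinuousLinearMap.snd ℝ _ _))

variable {L : LagSpace n k Q → ℝ} (hL : ContMDiff (lagI n k) 𝓘(ℝ, ℝ) ∞ L)
  {ψ : (Fin k → ℝ) → Pontryagin n k Q} {t : Fin k → ℝ}
  (hψ : MDifferentiableAt 𝓘(ℝ, Fin k → ℝ) (pontI n k) ψ t)
  {R : Fin k → TangentSpace (pontI n k) (ψ t)}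
  (hR : IsReebAt (pontI n k) contactForm (ψ t) R)
  (hZ : FieldEquationsAt (pontI n k) contactForm (hamiltonian L) (ψ t) R
    (fun α => velocity (pontI n k) ψ α t))

include hc hL hψ hR hZ

/-- This passes from components of `Z` at a point to derivatives along the section. The momentum
equation on `W` becomes one for `∂L/∂v`, and for that `ψ` must stay in `W_1` near `t`, not only at
`t`. -/
theorem coords_rho1_comp (ht : pontBase (ψ t) ∈ c.source)
    (hψ₁ : ∀ᶠ τ in 𝓝 t, ψ τ ∈ firstConstraint L) :
    DifferentiableAt ℝ (fun τ => toCoords c (rho1 (ψ τ))) t ∧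
    (∀ α, (fderiv ℝ (fun τ => toCoords c (rho1 (ψ τ))) t (Pi.single α 1)).1 =
      (toCoords c (rho1 (ψ t))).2.1 (Pi.single α 1)) ∧
    (∀ z, ∑ α, fderiv ℝ (coordMomentum (fun y => L (fromCoords c y)) α) (toCoords c (rho1 (ψ t)))
        (fderiv ℝ (fun τ => toCoords c (rho1 (ψ τ))) t (Pi.single α 1)) z =
      fderiv ℝ (fun y => L (fromCoords c y)) (toCoords c (rho1 (ψ t))) (z, 0, 0) +
      ∑ α, fderiv ℝ (fun y => L (fromCoords c y)) (toCoords c (rho1 (ψ t)))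
          (0, 0, Pi.single α 1) *
        coordMomentum (fun y => L (fromCoords c y)) α (toCoords c (rho1 (ψ t))) z) ∧
    ∑ α, (fderiv ℝ (fun τ => toCoords c (rho1 (ψ τ))) t (Pi.single α 1)).2.2 α =
      L (rho1 (ψ t)) := by
  have hΨ := isLocalCoords_pont hc ht
  obtain ⟨h1, h2, h3⟩ := skinnerRusk_equations hc hL ht hψ₁.self_of_nhds hR hZ
  have hP : DifferentiableAt ℝ (pontToCoords c ∘ ψ) t :=
    mdifferentiableAt_iff_differentiableAt.1 (hΨ.mdifferentiableAt.comp t hψ)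
  have hvel := fun α => hΨ.coordDeriv_velocity rfl hψ α
  have hY : HasFDerivAt (fun τ => toCoords c (rho1 (ψ τ)))
      (lagCoordsOfPont ∘L fderiv ℝ (pontToCoords c ∘ ψ) t) t :=
    (lagCoordsOfPont (n := n) (k := k)).hasFDerivAt.comp t hP.hasFDerivAt
  -- Both sides are derivatives at `t` of functions that coincide near `t`: `∂L/∂v_α` along `ρ_1 ∘
  -- ψ`, and the momentum `p^α` along `ψ`.
  have hmom : ∀ α, fderiv ℝ (coordMomentum (fun y => L (fromCoords c y)) α)
        (toCoords c (rho1 (ψ t))) ∘L fderiv ℝ (fun τ => toCoords c (rho1 (ψ τ))) t =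
      momCoord α ∘L fderiv ℝ (pontToCoords c ∘ ψ) t := by
    intro α
    have hm := differentiableAt_coordMomentum (contDiffAt_lagrangian hc hL (x := rho1 (ψ t)) ht) α
    have hl := HasFDerivAt.comp t hm.hasFDerivAt hY.differentiableAt.hasFDerivAt
    have hr := (momCoord (n := n) (k := k) α).hasFDerivAt.comp t hP.hasFDerivAt
    refine hl.unique (hr.congr_of_eventuallyEq ?_)
    filter_upwards [hψ₁, hψ.continuousAt.eventually (eventually_pontBase_mem_source ht)]
      with τ hτ hτ'
    ext z
    exact (momentum_eq_of_mem_firstConstraint hc hL hτ' hτ α z).symm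
  simp only [hvel] at h1 h2 h3
  refine ⟨hY.differentiableAt, fun α => ?_, fun z => ?_, ?_⟩
  · rw [hY.fderiv]; exact h1 α
  · rw [← h2 z]
    exact Finset.sum_congr rfl fun α _ =>
      DFunLike.congr_fun (DFunLike.congr_fun (hmom α) (Pi.single α 1)) z
  · rw [hY.fderiv]; exact h3

omit hc in
-- Holonomy, freed from coordinates: the injective chart derivative sends both sides, evaluated on
-- `∂/∂t^α`, to the same vector.
theorem mfderiv_pontBase_comp (hψ₁ : ψ t ∈ firstConstraint L) :
    (mfderiv 𝓘(ℝ, Fin k → ℝ) (𝓡 n) (fun τ => pontBase (ψ τ)) t :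
      (Fin k → ℝ) →L[ℝ] EuclideanSpace ℝ (Fin n)) = pontVel (ψ t) := by
  set c := chartAt (EuclideanSpace ℝ (Fin n)) (pontBase (ψ t))
  have hc : c ∈ IsManifold.maximalAtlas (𝓡 n) ∞ Q := IsManifold.chart_mem_maximalAtlas _
  have ht : pontBase (ψ t) ∈ c.source := mem_chart_source _ _
  have h1 := (skinnerRusk_equations hc hL ht hψ₁ hR hZ).1
  have hcomp := mfderiv_comp t (contMDiff_pontBase.mdifferentiableAt (by simp)) hψ
  have hinj : ∀ u u' : EuclideanSpace ℝ (Fin n),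
      chartDeriv c (pontBase (ψ t)) u = chartDeriv c (pontBase (ψ t)) u' → u = u' := by
    intro u u' h
    have h2 := chartSymmDeriv_comp_chartDeriv hc ht
    have h3 := congrArg (chartSymmDeriv c (c (pontBase (ψ t)))) h
    exact (DFunLike.congr_fun h2 u).symm.trans (h3.trans (DFunLike.congr_fun h2 u'))
  refine ContinuousLinearMap.coe_injective (LinearMap.pi_ext' fun α => LinearMap.ext_ring ?_)
  refine (DFunLike.congr_fun hcomp (Pi.single α 1)).trans (hinj _ _ ?_)
  exact (chartDeriv_mfderiv_pontBase hc ht (velocity (pontI n k) ψ α t)).trans (h1 α)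

variable {χ : (Fin k → ℝ) → LagSpace n k Q} (hχ : χ =ᶠ[𝓝 t] rho1 ∘ ψ)
include hχ

/-- Here `χ` stands for the first prolongation, which is known to agree with `ρ_1 ∘ ψ` only near
`t`; this suffices for first derivatives at `t`. -/
theorem eulerLagrangeCoords_at (ht : pontBase (ψ t) ∈ c.source)
    (hψ₁ : ∀ᶠ τ in 𝓝 t, ψ τ ∈ firstConstraint L) (i : Fin n) :
    ∑ α, partialDeriv (fun τ => dLdv c L i α (χ τ)) α t =
      dLdq c L i (χ t) + ∑ α, dLds c L α (χ t) * dLdv c L i α (χ t) := by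
  obtain ⟨hY, -, hp, -⟩ := coords_rho1_comp hc hL hψ hR hZ ht hψ₁
  have ht' : χ t = rho1 (ψ t) := hχ.self_of_nhds
  rw [ht']
  -- On the basis vector `e_i` the momenta and the derivatives of `L` are by definition `dLdv`,
  -- `dLdq` and `dLds`.
  refine Eq.trans (Finset.sum_congr rfl fun α _ => ?_) (hp (EuclideanSpace.single i 1))
  have hm := differentiableAt_coordMomentum (contDiffAt_lagrangian hc hL (x := rho1 (ψ t)) ht) α
  have hl := HasFDerivAt.comp t hm.hasFDerivAt hY.hasFDerivAt
  have hl' := (hl.clm_apply (hasFDerivAt_const (EuclideanSpace.single i (1 : ℝ)) t)).congr_of_eventuallyEq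
    (f₁ := fun τ => dLdv c L i α (χ τ)) (by
      filter_upwards [hχ] with τ hτ
      rw [hτ]; rfl)
  rw [partialDeriv, hl'.fderiv]
  simp

omit hc in
theorem sum_partialDeriv_snd (hψ₁ : ∀ᶠ τ in 𝓝 t, ψ τ ∈ firstConstraint L) :
    ∑ α, partialDeriv (fun τ => (χ τ).2 α) α t = L (χ t) := by
  set c := chartAt (EuclideanSpace ℝ (Fin n)) (pontBase (ψ t))
  have hc : c ∈ IsManifold.maximalAtlas (𝓡 n) ∞ Q := IsManifold.chart_mem_maximalAtlas _
  have ht : pontBase (ψ t) ∈ c.source := mem_chart_source _ _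
  obtain ⟨hY, -, -, hs⟩ := coords_rho1_comp hc hL hψ hR hZ ht hψ₁
  have ht' : χ t = rho1 (ψ t) := hχ.self_of_nhds
  rw [ht', ← hs]
  refine Finset.sum_congr rfl fun α _ => ?_
  let A : LagCoords n k →L[ℝ] ℝ :=
    ContinuousLinearMap.proj (R := ℝ) (φ := fun _ : Fin k => ℝ) α ∘L
      ContinuousLinearMap.snd ℝ _ _ ∘L ContinuousLinearMap.snd ℝ _ _
  have h := (A.hasFDerivAt.comp t hY.hasFDerivAt).congr_of_eventuallyEq
    (f₁ := fun τ => (χ τ).2 α) (by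
      filter_upwards [hχ] with τ hτ
      rw [hτ]; rfl)
  rw [partialDeriv, h.fderiv]
  rfl

omit hc in
theorem eulerLagrangeGeometric_at (hψ₁ : ∀ᶠ τ in 𝓝 t, ψ τ ∈ firstConstraint L)
    {R' : Fin k → TangentSpace (lagI n k) (χ t)}
    (hR' : IsReebAt (lagI n k) (lagContactForm L) (χ t) R') :
    FieldEquationsAt (lagI n k) (lagContactForm L) (energy L) (χ t) R'
      (fun α => velocity (lagI n k) χ α t) := by
  set c := chartAt (EuclideanSpace ℝ (Fin n)) (pontBase (ψ t))
  have hc : c ∈ IsManifold.maximalAtlas (𝓡 n) ∞ Q := IsManifold.chart_mem_maximalAtlas _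
  have ht : pontBase (ψ t) ∈ c.source := mem_chart_source _ _
  obtain ⟨hY, hq, hp, hs⟩ := coords_rho1_comp hc hL hψ hR hZ ht hψ₁
  have ht' : χ t = rho1 (ψ t) := hχ.self_of_nhds
  have hx : tauQ (χ t) ∈ c.source := by rw [ht']; exact ht
  have hΨ := isLocalCoords_lag hc hx
  have hχY : toCoords c ∘ χ =ᶠ[𝓝 t] fun τ => toCoords c (rho1 (ψ τ)) := by
    filter_upwards [hχ] with τ hτ
    exact congrArg (toCoords c) hτ
  -- Differentiability of `χ` is recovered from that of its coordinate expression.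
  have hχd : MDifferentiableAt 𝓘(ℝ, Fin k → ℝ) (lagI n k) χ t := by
    have h1 : MDifferentiableAt 𝓘(ℝ, Fin k → ℝ) (lagI n k)
        (fromCoords c ∘ fun τ => toCoords c (rho1 (ψ τ))) t := by
      refine MDifferentiableAt.comp t ?_ hY.mdifferentiableAt
      exact (isLocalCoords_lag hc (x := rho1 (ψ t)) ht).mdifferentiableAt_symm
    refine h1.congr_of_eventuallyEq ?_
    filter_upwards [hχ, hψ.continuousAt.eventually (eventually_pontBase_mem_source ht)]
      with τ hτ hτ'
    exact hτ.trans (fromCoords_toCoords hc (x := rho1 (ψ τ)) hτ').symm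
  have hvel : ∀ α, coordDeriv (lagI n k) (toCoords c) (χ t) (velocity (lagI n k) χ α t) =
      fderiv ℝ (fun τ => toCoords c (rho1 (ψ τ))) t (Pi.single α 1) := fun α => by
    rw [← hχY.fderiv_eq]; exact hΨ.coordDeriv_velocity rfl hχd α
  refine fieldEquationsAt_lagContactForm hc hL hx hR' (fun α => ?_) (fun z => ?_) ?_
  · rw [hvel, ht']; exact hq α
  · simp only [hvel]
    rw [ht']
    exact hp z
  · simp only [hvel]
    rw [ht']
    exact hs

end Sections

end KContact

end

theorem mainTheorem9 {n k : ℕ} {Q : Type*} [TopologicalSpace Q]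
    [ChartedSpace (EuclideanSpace ℝ (Fin n)) Q] [IsManifold (𝓡 n) ∞ Q]
    (L : KContact.LagSpace n k Q → ℝ)
    (hL : ContMDiff (KContact.lagI n k) 𝓘(ℝ, ℝ) ∞ L)
    (R : Fin k → ∀ w : KContact.Pontryagin n k Q, TangentSpace (KContact.pontI n k) w)
    (hR : KContact.IsReebFamily (KContact.pontI n k) KContact.contactForm R)
    (Z : Fin k → ∀ w : KContact.Pontryagin n k Q, TangentSpace (KContact.pontI n k) w)
    (hZsmooth : ∀ α, KContact.IsSmoothField (KContact.pontI n k) (Z α))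
    (S : Set (KContact.Pontryagin n k Q))
    (hS : S ⊆ KContact.firstConstraint L)
    (hZ : KContact.SolvesSkinnerRuskOn L R Z S)
    (hZint : KContact.IsIntegrableOn (KContact.pontI n k) Z S)
    (U : Set (Fin k → ℝ)) (ψ : (Fin k → ℝ) → KContact.Pontryagin n k Q)
    (hψ : KContact.IsIntegralSection (KContact.pontI n k) Z U ψ)
    (hψS : Set.MapsTo ψ U S) :
    Set.EqOn (KContact.rho1 ∘ ψ) (KContact.prolongation (KContact.tau0 ∘ KContact.rho1 ∘ ψ)) U ∧
      KContact.IsEulerLagrangeSolution L U (KContact.tau0 ∘ KContact.rho1 ∘ ψ) := by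
  obtain ⟨hU, hψsmooth, hψvel⟩ := hψ
  have hnhds : ∀ t ∈ U, ∀ᶠ τ in nhds t, τ ∈ U := fun t ht => hU.mem_nhds ht
  have hψd : ∀ t ∈ U, MDifferentiableAt 𝓘(ℝ, Fin k → ℝ) (KContact.pontI n k) ψ t := fun t ht =>
    (hψsmooth.contMDiffAt (hU.mem_nhds ht)).mdifferentiableAt (by simp)
  have hψ₁ : ∀ t ∈ U, ∀ᶠ τ in nhds t, ψ τ ∈ KContact.firstConstraint L := fun t ht =>
    (hnhds t ht).mono fun τ hτ => hS (hψS hτ)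
  have hfield : ∀ t ∈ U, KContact.FieldEquationsAt (KContact.pontI n k) KContact.contactForm
      (KContact.hamiltonian L) (ψ t) (fun α => R α (ψ t))
      (fun α => KContact.velocity (KContact.pontI n k) ψ α t) := fun t ht => by
    have h := hZ (ψ t) (hψS ht)
    rwa [show (fun α => Z α (ψ t)) = fun α => KContact.velocity (KContact.pontI n k) ψ α t from
      funext fun α => (hψvel t ht α).symm] at h
  have hprol : Set.EqOn (KContact.rho1 ∘ ψ)
      (KContact.prolongation (KContact.tau0 ∘ KContact.rho1 ∘ ψ)) U := fun t ht => by
    have h := KContact.mfderiv_pontBase_comp hL (hψd t ht) (hR.2 (ψ t)) (hfield t ht)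
      (hψ₁ t ht).self_of_nhds
    exact congrArg (KContact.fibreIncl (KContact.pontBase (ψ t)) (ψ t).2) h.symm
  -- Outside `U` the prolongation need not be related to `ψ`; openness of `U` makes the germs agree
  -- at its points.
  have hχ : ∀ t ∈ U, KContact.prolongation (KContact.tau0 ∘ KContact.rho1 ∘ ψ) =ᶠ[nhds t]
      KContact.rho1 ∘ ψ := fun t ht => (hnhds t ht).mono fun τ hτ => (hprol hτ).symm
  refine ⟨hprol, ?_, fun t ht R' hR' => ?_, fun c hc t ht htc i => ?_, fun t ht => ?_⟩
  · intro t ht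
    have h : ContMDiffWithinAt 𝓘(ℝ, Fin k → ℝ) 𝓘(ℝ, Fin k → ℝ) ∞ (fun τ => (ψ τ).2) U t :=
      contMDiffAt_snd.comp_contMDiffWithinAt t (hψsmooth t ht)
    exact (KContact.contMDiff_pontBase.contMDiffAt.comp_contMDiffWithinAt t
      (hψsmooth t ht)).prodMk h
  · exact KContact.eulerLagrangeGeometric_at hL (hψd t ht) (hR.2 (ψ t)) (hfield t ht)
      (hχ t ht) (hψ₁ t ht) hR'
  · exact KContact.eulerLagrangeCoords_at hc hL (hψd t ht) (hR.2 (ψ t)) (hfield t ht)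
      (hχ t ht) htc (hψ₁ t ht) i
  · exact KContact.sum_partialDeriv_snd hL (hψd t ht) (hR.2 (ψ t)) (hfield t ht)
      (hχ t ht) (hψ₁ t ht)
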